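/- For $n\ge 0$ let $\mathbb{C}\{z_1,\dots,z_n\}$ be the $\mathbb{C}$-algebra of convergent complex power series (the formal power series $\sum_m a_m z^m$ with $\sum_m |a_m|\, r^{|m|}<\infty$ for some $r>0$), a local ring with maximal ideal $\{f \mid f(0)=0\}$, and let $\mathbb{C}\{t\}$ be the same ring in one variable $t$. A homomorphism of local $\mathbb{C}$-algebras is called local if it maps the maximal ideal into the maximal ideal. For a proper ideal $I\subset\mathbb{C}\{z_1,\dots,z_n\}$ let $\operatorname{Mor}(\mathbb{C}\{z_1,\dots,z_n\}/I,\mathbb{C}\{t\})$ be the set of local homomorphisms of $\mathbb{C}$-algebras $\mathbb{C}\{z_1,\dots,z_n\}/I\to\mathbb{C}\{t\}$, regarded, by composition with the quotient map, as a subset of the set of local homomorphisms of $\mathbb{C}$-algebras $\mathbb{C}\{z_1,\dots,z_n\}\to\mathbb{C}\{t\}$. Then the following two (equivalent) statements hold. (1) (Curve selection lemma) Let $\mathfrak{p}\subset\mathbb{C}\{z_1,\dots,z_n\}$ be a proper prime ideal and let $h\notin\mathfrak{p}$. Then there exists a local homomorphism of $\mathbb{C}$-algebras $\phi\colon\mathbb{C}\{z_1,\dots,z_n\}\to\mathbb{C}\{t\}$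 such that $\phi(\mathfrak{p})=0$ and $\phi(h)\neq 0$. (2) (Rückert's Nullstellensatz) Let $I,J\subset\mathbb{C}\{z_1,\dots,z_n\}$ be proper ideals. Then $$\operatorname{Mor}(\mathbb{C}\{z_1,\dots,z_n\}/I,\mathbb{C}\{t\})=\operatorname{Mor}(\mathbb{C}\{z_1,\dots,z_n\}/J,\mathbb{C}\{t\})\iff\sqrt{I}=\sqrt{J},$$ where the left-hand equality is an equality of subsets of the set of local homomorphisms of $\mathbb{C}$-algebras $\mathbb{C}\{z_1,\dots,z_n\}\to\mathbb{C}\{t\}$. -/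

import Mathlib

/-- The formal power series `f = ∑ aₘ zᵐ` with complex coefficients, in the variables indexed by
`σ`, is convergent if it converges absolutely on some polydisc of radius `r > 0` centred at the
origin, that is, if `∑ |aₘ| r ^ |m| < ∞` for some `r > 0`. -/
def IsConvergentSeries {σ : Type*} (f : MvPowerSeries σ ℂ) : Prop :=
  ∃ r : ℝ, 0 < r ∧ Summable fun m : σ →₀ ℕ => ‖MvPowerSeries.coeff m f‖ * r ^ m.degree

namespace IsConvergentSeries

theorem summable_of_le {σ : Type*} {f : MvPowerSeries σ ℂ} {r s : ℝ} (hs : 0 ≤ s) (hsr : s ≤ r)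
    (h : Summable fun m : σ →₀ ℕ => ‖MvPowerSeries.coeff m f‖ * r ^ m.degree) :
    Summable fun m : σ →₀ ℕ => ‖MvPowerSeries.coeff m f‖ * s ^ m.degree :=
  h.of_nonneg_of_le (fun m => by positivity) (fun m => by gcongr)

theorem algebraMap {σ : Type*} (c : ℂ) :
    IsConvergentSeries (algebraMap ℂ (MvPowerSeries σ ℂ) c) := by
  classical
  refine ⟨1, one_pos, summable_of_ne_finset_zero (s := {0}) fun m hm => ?_⟩
  have hm' : m ≠ 0 := by simpa using hm
  simp [MvPowerSeries.algebraMap_apply, MvPowerSeries.coeff_C, hm']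

theorem add {σ : Type*} {f g : MvPowerSeries σ ℂ} (hf : IsConvergentSeries f)
    (hg : IsConvergentSeries g) : IsConvergentSeries (f + g) := by
  obtain ⟨r, hr, hf⟩ := hf
  obtain ⟨s, hs, hg⟩ := hg
  have ht : 0 < min r s := lt_min hr hs
  refine ⟨min r s, ht, ((summable_of_le ht.le (min_le_left r s) hf).add
    (summable_of_le ht.le (min_le_right r s) hg)).of_nonneg_of_le
      (fun m => by positivity) (fun m => ?_)⟩
  rw [map_add, ← add_mul]
  gcongr
  exact norm_add_le _ _

theorem summable_cauchy {σ : Type*} [DecidableEq σ] {u v : (σ →₀ ℕ) → ℝ} (hu0 : ∀ m, 0 ≤ u m)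
    (hv0 : ∀ m, 0 ≤ v m) (hu : Summable u) (hv : Summable v) :
    Summable fun m => ∑ x ∈ Finset.HasAntidiagonal.antidiagonal m, u x.1 * v x.2 :=
  summable_sum_mul_antidiagonal_of_summable_mul (hu.mul_of_nonneg hv hu0 hv0)

theorem mul {σ : Type*} {f g : MvPowerSeries σ ℂ} (hf : IsConvergentSeries f)
    (hg : IsConvergentSeries g) : IsConvergentSeries (f * g) := by
  classical
  obtain ⟨r, hr, hf⟩ := hf
  obtain ⟨s, hs, hg⟩ := hg
  obtain ⟨t, ht, htr, hts⟩ : ∃ t : ℝ, 0 < t ∧ t ≤ r ∧ t ≤ s :=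
    ⟨min r s, lt_min hr hs, min_le_left r s, min_le_right r s⟩
  have hn : ∀ (F : MvPowerSeries σ ℂ) (m : σ →₀ ℕ),
      0 ≤ ‖MvPowerSeries.coeff m F‖ * t ^ m.degree :=
    fun F m => mul_nonneg (norm_nonneg _) (pow_nonneg ht.le _)
  have key := summable_cauchy (hn f) (hn g) (summable_of_le ht.le htr hf)
    (summable_of_le ht.le hts hg)
  refine ⟨t, ht, Summable.of_nonneg_of_le (hn (f * g)) (fun m => ?_) key⟩
  rw [MvPowerSeries.coeff_mul]
  refine (mul_le_mul_of_nonneg_right (norm_sum_le _ _) (pow_nonneg ht.le _)).trans ?_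
  rw [Finset.sum_mul]
  refine Finset.sum_le_sum fun x hx => le_of_eq ?_
  rw [← Finset.HasAntidiagonal.mem_antidiagonal.mp hx, map_add, pow_add, norm_mul]
  ring

end IsConvergentSeries

/-- The `ℂ`-algebra of convergent power series with complex coefficients in the variables indexed
by `σ`, as a subalgebra of the algebra of formal power series. -/
def convergentSeries (σ : Type*) : Subalgebra ℂ (MvPowerSeries σ ℂ) where
  carrier := {f | IsConvergentSeries f}
  mul_mem' hf hg := hf.mul hg
  add_mem' hf hg := hf.add hg
  algebraMap_mem' c := IsConvergentSeries.algebraMap c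

/-- The ring `ℂ{z₁, …, zₙ}`. -/
abbrev ConvSeries (n : ℕ) : Type := convergentSeries (Fin n)

/-- The ring `ℂ{t}`, inside Mathlib's `PowerSeries ℂ = MvPowerSeries Unit ℂ`. -/
abbrev ConvSeriesOne : Type := convergentSeries Unit

/-- The local homomorphisms of `ℂ`-algebras `A → B`. -/
abbrev LocalAlgHom (A B : Type*) [CommRing A] [Algebra ℂ A] [CommRing B] [Algebra ℂ B] : Type _ :=
  {φ : A →ₐ[ℂ] B // IsLocalHom φ}

/-- The `ℂ{t}`-valued points of `I`: the local homomorphisms `ℂ{z₁, …, zₙ}/I → ℂ{t}` of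
`ℂ`-algebras, seen as local homomorphisms `ℂ{z₁, …, zₙ} → ℂ{t}` by composition with the
quotient map. -/
def curvePoints {n : ℕ} (I : Ideal (ConvSeries n)) : Set (LocalAlgHom (ConvSeries n) ConvSeriesOne) :=
  {φ | ∃ ψ : LocalAlgHom (ConvSeries n ⧸ I) ConvSeriesOne,
    ψ.1.comp (Ideal.Quotient.mkₐ ℂ I) = φ.1}

/-! Curve selection goes by induction on the number of variables. If `p = 0`, a line through the
origin on which `h` does not vanish is a suitable curve. Otherwise, after a linear change of
coordinates, `p` contains an `f` regular of some order `k` in the last variable. Weierstrass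
division by `f` shows that `A = ℂ{z', w}/p` is generated over `ℂ{z'}` by the class `y` of `w`, and
that `y` is a root of a monic polynomial `W`. By integrality, the class of `h` divides a nonzero
element of `A` that comes from some `b` in `ℂ{z'}`. The induction hypothesis, applied to the kernel
of `ℂ{z'} → A` and to `b`, gives a curve `φ'` in fewer variables. Along `φ'` the polynomial `W`
becomes monic over `ℂ{t}`, and by Newton–Puiseux it splits after some `t ↦ t ^ l`. Hence `φ'`
followed by this ramification extends to `A`, with `y` going to one of the roots. The extension does
not kill `h`, because it does not kill `b`.

The analytic input is Weierstrass division, a linear fixed point problem that is contracting for a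
weighted `ℓ¹` norm on a well-chosen polydisc. Newton–Puiseux is deduced from it: division plays the
role of Hensel's lemma, so Puiseux series need no convergence estimate of their own. Locality of
homomorphisms is automatic (`eval₀_algHom`).

For the Nullstellensatz, the points of `I` are the `φ` that vanish on `I`, and they depend only on
`√I` because `ℂ{t}` is reduced. Conversely, if `f` avoids a prime `p ⊇ J`, curve selection gives a
point of `J` that does not kill `f`. So if all points of `J` are points of `I`, then `√I ⊆ √J`. -/

open scoped ENNReal NNReal

/-! ### Weighted `ℓ¹` norms and convergence -/

namespace MvPowerSeries

variable {σ τ : Type*}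

/-- The monomial `ρ ^ m`. -/
noncomputable def polyradiusPow (ρ : σ → ℝ≥0) (m : σ →₀ ℕ) : ℝ≥0 := m.prod fun i k => ρ i ^ k

/-- The weighted `ℓ¹` norm `∑ |aₘ| ρ ^ m` of a power series. -/
noncomputable def wnorm (ρ : σ → ℝ≥0) (f : MvPowerSeries σ ℂ) : ℝ≥0∞ :=
  ∑' m, ‖coeff m f‖ₑ * polyradiusPow ρ m

theorem polyradiusPow_add (ρ : σ → ℝ≥0) (m n : σ →₀ ℕ) :
    polyradiusPow ρ (m + n) = polyradiusPow ρ m * polyradiusPow ρ n := by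
  classical
  exact Finsupp.prod_add_index' (by simp) (by simp [pow_add])

@[simp] theorem polyradiusPow_zero (ρ : σ → ℝ≥0) : polyradiusPow ρ 0 = 1 := by
  simp [polyradiusPow]

@[simp] theorem polyradiusPow_single (ρ : σ → ℝ≥0) (i : σ) (k : ℕ) :
    polyradiusPow ρ (Finsupp.single i k) = ρ i ^ k := by
  simp [polyradiusPow]

theorem polyradiusPow_const (r : ℝ≥0) (m : σ →₀ ℕ) :
    polyradiusPow (fun _ => r) m = r ^ m.degree := by
  simp [polyradiusPow, Finsupp.prod, Finset.prod_pow_eq_pow_sum, Finsupp.degree_apply]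

theorem polyradiusPow_pos {ρ : σ → ℝ≥0} (hρ : ∀ i, 0 < ρ i) (m : σ →₀ ℕ) :
    0 < polyradiusPow ρ m :=
  Finset.prod_pos fun i _ => pow_pos (hρ i) _

theorem polyradiusPow_mono {ρ ρ' : σ → ℝ≥0} (h : ρ ≤ ρ') (m : σ →₀ ℕ) :
    polyradiusPow ρ m ≤ polyradiusPow ρ' m :=
  Finset.prod_le_prod' fun i _ => pow_le_pow_left' (h i) _

theorem polyradiusPow_smul (c : ℝ≥0) (ρ : σ → ℝ≥0) (m : σ →₀ ℕ) :
    polyradiusPow (c • ρ) m = c ^ m.degree * polyradiusPow ρ m := by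
  simp [polyradiusPow, Finsupp.prod, mul_pow, Finset.prod_mul_distrib, Finset.prod_pow_eq_pow_sum,
    Finsupp.degree_apply]

theorem le_wnorm (ρ : σ → ℝ≥0) (f : MvPowerSeries σ ℂ) (m : σ →₀ ℕ) :
    ‖coeff m f‖ₑ * polyradiusPow ρ m ≤ wnorm ρ f :=
  ENNReal.le_tsum m

theorem wnorm_mono {ρ ρ' : σ → ℝ≥0} (h : ρ ≤ ρ') (f : MvPowerSeries σ ℂ) :
    wnorm ρ f ≤ wnorm ρ' f :=
  ENNReal.tsum_le_tsum fun m => by gcongr; exact polyradiusPow_mono h m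

theorem wnorm_add_le (ρ : σ → ℝ≥0) (f g : MvPowerSeries σ ℂ) :
    wnorm ρ (f + g) ≤ wnorm ρ f + wnorm ρ g := by
  rw [wnorm, wnorm, wnorm, ← ENNReal.tsum_add]
  refine ENNReal.tsum_le_tsum fun m => ?_
  rw [← add_mul, map_add]
  gcongr
  exact enorm_add_le _ _

theorem wnorm_smul (ρ : σ → ℝ≥0) (c : ℂ) (f : MvPowerSeries σ ℂ) :
    wnorm ρ (c • f) = ‖c‖ₑ * wnorm ρ f := by
  rw [wnorm, wnorm, ← ENNReal.tsum_mul_left]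
  simp [mul_assoc, enorm_mul]

theorem wnorm_neg (ρ : σ → ℝ≥0) (f : MvPowerSeries σ ℂ) : wnorm ρ (-f) = wnorm ρ f := by
  simp [wnorm]

@[simp] theorem wnorm_monomial (ρ : σ → ℝ≥0) (n : σ →₀ ℕ) (c : ℂ) :
    wnorm ρ (monomial n c) = ‖c‖ₑ * polyradiusPow ρ n := by
  classical
  rw [wnorm, tsum_eq_single n]
  · simp
  · intro m hm
    simp [coeff_monomial, hm]

@[simp] theorem wnorm_one (ρ : σ → ℝ≥0) : wnorm ρ (1 : MvPowerSeries σ ℂ) = 1 := by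
  rw [← monomial_zero_one, wnorm_monomial]; simp

theorem wnorm_mul_le (ρ : σ → ℝ≥0) (f g : MvPowerSeries σ ℂ) :
    wnorm ρ (f * g) ≤ wnorm ρ f * wnorm ρ g := by
  classical
  calc wnorm ρ (f * g) ≤ ∑' m : σ →₀ ℕ, ∑' x : Finset.HasAntidiagonal.antidiagonal m,
        (‖coeff x.1.1 f‖ₑ * polyradiusPow ρ x.1.1) * (‖coeff x.1.2 g‖ₑ * polyradiusPow ρ x.1.2) :=
            by
        refine ENNReal.tsum_le_tsum fun m => ?_
        rw [coeff_mul, Finset.tsum_subtype (Finset.HasAntidiagonal.antidiagonal m)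
          fun x : (σ →₀ ℕ) × (σ →₀ ℕ) =>
            (‖coeff x.1 f‖ₑ * polyradiusPow ρ x.1) * (‖coeff x.2 g‖ₑ * (polyradiusPow ρ x.2 :
                ℝ≥0∞))]
        refine (mul_le_mul_left (enorm_sum_le _ _) _).trans ?_
        rw [Finset.sum_mul]
        refine Finset.sum_le_sum fun x hx => le_of_eq ?_
        rw [← Finset.HasAntidiagonal.mem_antidiagonal.mp hx, polyradiusPow_add, enorm_mul,
          ENNReal.coe_mul]
        ring
    _ = ∑' x : (σ →₀ ℕ) × (σ →₀ ℕ),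
        (‖coeff x.1 f‖ₑ * polyradiusPow ρ x.1) * (‖coeff x.2 g‖ₑ * polyradiusPow ρ x.2) := by
        rw [← Finset.HasAntidiagonal.sigmaAntidiagonalEquivProd.tsum_eq, ENNReal.tsum_sigma']
        rfl
    _ = wnorm ρ f * wnorm ρ g := by
        rw [ENNReal.tsum_prod', wnorm, wnorm, ← ENNReal.tsum_mul_right]
        simp_rw [ENNReal.tsum_mul_left]

theorem wnorm_pow_le (ρ : σ → ℝ≥0) (f : MvPowerSeries σ ℂ) (n : ℕ) :
    wnorm ρ (f ^ n) ≤ wnorm ρ f ^ n := by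
  induction n with
  | zero => simp
  | succ n ih =>
    rw [pow_succ, pow_succ]
    exact (wnorm_mul_le _ _ _).trans (mul_le_mul_left ih _)

theorem wnorm_prod_le {ι : Type*} (ρ : σ → ℝ≥0) (s : Finset ι) (f : ι → MvPowerSeries σ ℂ) :
    wnorm ρ (∏ i ∈ s, f i) ≤ ∏ i ∈ s, wnorm ρ (f i) := by
  classical
  induction s using Finset.induction_on with
  | empty => simp
  | insert a s ha ih =>
    rw [Finset.prod_insert ha, Finset.prod_insert ha]
    exact (wnorm_mul_le _ _ _).trans (mul_le_mul_right ih _)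

/-- The countable triangle inequality in coefficientwise form: it applies to sums defined one
coefficient at a time, without any topology on power series. -/
theorem wnorm_le_tsum {ι : Type*} (ρ : σ → ℝ≥0) {f : MvPowerSeries σ ℂ}
    {g : ι → MvPowerSeries σ ℂ} (h : ∀ m, ‖coeff m f‖ₑ ≤ ∑' i, ‖coeff m (g i)‖ₑ) :
    wnorm ρ f ≤ ∑' i, wnorm ρ (g i) := by
  simp_rw [wnorm]
  rw [ENNReal.tsum_comm]
  refine ENNReal.tsum_le_tsum fun m => ?_
  rw [ENNReal.tsum_mul_right]
  gcongr
  exact h m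

theorem eq_zero_of_wnorm_eq_zero {ρ : σ → ℝ≥0} (hρ : ∀ i, 0 < ρ i) {f : MvPowerSeries σ ℂ}
    (h : wnorm ρ f = 0) : f = 0 := by
  ext m
  have := (ENNReal.tsum_eq_zero.mp h) m
  simpa [(polyradiusPow_pos hρ m).ne'] using this

/-- A contraction of the weighted `ℓ¹` norm that is linear has a fixed point after translation. -/
theorem exists_eq_add_of_contracting {ρ : σ → ℝ≥0} (hρ : ∀ i, 0 < ρ i)
    (K : MvPowerSeries σ ℂ →ₗ[ℂ] MvPowerSeries σ ℂ) {c : ℝ≥0∞} (hc : c < 1)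
    (hK : ∀ q, wnorm ρ (K q) ≤ c * wnorm ρ q) (g : MvPowerSeries σ ℂ) (hg : wnorm ρ g ≠ ⊤) :
    ∃ q, wnorm ρ q ≠ ⊤ ∧ q = g + K q := by
  -- The solution is the Neumann series `∑ Kʲ g`, summed coefficient by coefficient.
  set u : ℕ → MvPowerSeries σ ℂ := fun j => (K^[j]) g with hu
  have hun : ∀ j, wnorm ρ (u j) ≤ c ^ j * wnorm ρ g := by
    intro j
    induction j with
    | zero => simp [hu]
    | succ j ih =>
      have : u (j + 1) = K (u j) := Function.iterate_succ_apply' _ _ _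
      rw [this, pow_succ', mul_assoc]
      exact (hK _).trans (mul_le_mul_right ih _)
  have hfin : ∑' j, wnorm ρ (u j) ≠ ⊤ := by
    refine ne_top_of_le_ne_top ?_ (ENNReal.tsum_le_tsum hun)
    rw [ENNReal.tsum_mul_right]
    refine ENNReal.mul_ne_top ?_ hg
    rw [ENNReal.tsum_geometric]
    simpa [tsub_eq_zero_iff_le] using hc
  have hsum : ∀ m, Summable fun j => coeff m (u j) := by
    intro m
    have h1 : (∑' j, ‖coeff m (u j)‖ₑ) ≠ ⊤ := by
      have h2 : (∑' j, ‖coeff m (u j)‖ₑ) * polyradiusPow ρ m ≤ ∑' j, wnorm ρ (u j) := by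
        rw [← ENNReal.tsum_mul_right]
        exact ENNReal.tsum_le_tsum fun j => le_wnorm _ _ _
      intro h3
      rw [h3, ENNReal.top_mul (by simpa using (polyradiusPow_pos hρ m).ne')] at h2
      exact hfin (top_le_iff.mp h2)
    refine Summable.of_norm ?_
    have := ENNReal.summable_toReal h1
    simpa using this
  set q : MvPowerSeries σ ℂ := fun m => ∑' j, coeff m (u j) with hq
  have hqc : ∀ m, coeff m q = ∑' j, coeff m (u j) := fun m => rfl
  have hdiff : ∀ J, wnorm ρ (q - ∑ j ∈ Finset.range J, u j) ≤ ∑' j, wnorm ρ (u (j + J)) := by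
    intro J
    refine wnorm_le_tsum ρ fun m => ?_
    rw [map_sub, hqc, map_sum, ← (hsum m).sum_add_tsum_nat_add J, add_sub_cancel_left]
    exact enorm_tsum_le_tsum_enorm
  have hlim : Filter.Tendsto (fun J => ∑' j, wnorm ρ (u (j + J))) Filter.atTop (nhds 0) :=
    ENNReal.tendsto_sum_nat_add _ hfin
  refine ⟨q, ?_, ?_⟩
  · have := hdiff 0
    simp only [Finset.range_zero, Finset.sum_empty, sub_zero, add_zero] at this
    exact ne_top_of_le_ne_top hfin this
  · rw [← sub_eq_zero]
    refine eq_zero_of_wnorm_eq_zero hρ (le_antisymm ?_ bot_le)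
    -- With `S_J` the `J`-th partial sum, `S_{J+1} = g + K S_J`, so the defect of `q` is `(q -
    -- S_{J+1}) - K (q - S_J)`. Both terms are controlled by tails, and `K` is used only through its
    -- norm bound.
    have hbound : ∀ J, wnorm ρ (q - (g + K q)) ≤
        (∑' j, wnorm ρ (u (j + (J + 1)))) + c * ∑' j, wnorm ρ (u (j + J)) := by
      intro J
      have h1 : q - (g + K q) = (q - ∑ j ∈ Finset.range (J + 1), u j) +
          -(K (q - ∑ j ∈ Finset.range J, u j)) := by
        have h2 : ∑ j ∈ Finset.range (J + 1), u j = g + K (∑ j ∈ Finset.range J, u j) := by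
          rw [Finset.sum_range_succ', add_comm, map_sum]
          simp [hu, Function.iterate_succ_apply']
        rw [h2, map_sub]; abel
      rw [h1]
      refine (wnorm_add_le _ _ _).trans (add_le_add (hdiff _) ?_)
      rw [wnorm_neg]
      exact (hK _).trans (mul_le_mul_right (hdiff J) _)
    have hlim2 := (hlim.comp (Filter.tendsto_add_atTop_nat 1)).add
      (ENNReal.Tendsto.const_mul (a := c) hlim (Or.inr (hc.trans ENNReal.one_lt_top).ne))
    simp only [mul_zero, add_zero] at hlim2
    exact ge_of_tendsto' hlim2 hbound

theorem isConvergentSeries_iff_const {f : MvPowerSeries σ ℂ} :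
    IsConvergentSeries f ↔ ∃ r : ℝ≥0, 0 < r ∧ wnorm (fun _ => r) f ≠ ⊤ := by
  have key : ∀ (r : ℝ≥0) (m : σ →₀ ℕ), ‖coeff m f‖ₑ * polyradiusPow (fun _ => r) m =
      ((‖coeff m f‖₊ * r ^ m.degree : ℝ≥0) : ℝ≥0∞) := by
    intro r m
    rw [polyradiusPow_const]
    simp [enorm_eq_nnnorm]
  constructor
  · rintro ⟨r, hr, h⟩
    lift r to ℝ≥0 using hr.le
    refine ⟨r, by exact_mod_cast hr, ?_⟩
    rw [wnorm]
    simp_rw [key]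
    rw [ENNReal.tsum_coe_ne_top_iff_summable, ← NNReal.summable_coe]
    simpa using h
  · rintro ⟨r, hr, h⟩
    refine ⟨r, by exact_mod_cast hr, ?_⟩
    rw [wnorm] at h
    simp_rw [key] at h
    rw [ENNReal.tsum_coe_ne_top_iff_summable, ← NNReal.summable_coe] at h
    simpa using h

theorem isConvergentSeries_of_wnorm_ne_top [Finite σ] {f : MvPowerSeries σ ℂ} {ρ : σ → ℝ≥0}
    (hρ : ∀ i, 0 < ρ i) (h : wnorm ρ f ≠ ⊤) : IsConvergentSeries f := by
  cases nonempty_fintype σ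
  obtain ⟨r, hr, hr'⟩ : ∃ r : ℝ≥0, 0 < r ∧ ∀ i, r ≤ ρ i := by
    cases isEmpty_or_nonempty σ
    · exact ⟨1, one_pos, fun i => isEmptyElim i⟩
    · obtain ⟨i, hi⟩ := Finite.exists_min ρ
      exact ⟨ρ i, hρ i, hi⟩
  exact isConvergentSeries_iff_const.mpr ⟨r, hr, ne_top_of_le_ne_top h (wnorm_mono hr' f)⟩

/-- A convergent series without constant term has small norm on small polydiscs. -/
theorem wnorm_smul_le_of_constantCoeff_eq_zero {f : MvPowerSeries σ ℂ}
    (hf : constantCoeff f = 0) {c : ℝ≥0} (hc : c ≤ 1) (ρ : σ → ℝ≥0) :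
    wnorm (c • ρ) f ≤ c * wnorm ρ f := by
  rw [wnorm, wnorm, ← ENNReal.tsum_mul_left]
  refine ENNReal.tsum_le_tsum fun m => ?_
  by_cases hm : m = 0
  · subst hm
    simp [hf]
  · have h1 : c ^ m.degree ≤ c := by
      have : m.degree ≠ 0 := by simpa [Finsupp.degree_eq_zero_iff] using hm
      exact pow_le_of_le_one zero_le hc this
    rw [polyradiusPow_smul, ENNReal.coe_mul, mul_left_comm]
    gcongr

/-! ### Division by powers of a variable, and substitution -/

/-- The quotient of `f` by `Xᵢᵏ`, dropping the monomials that are not divisible. -/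
noncomputable def divXPow (i : σ) (k : ℕ) : MvPowerSeries σ ℂ →ₗ[ℂ] MvPowerSeries σ ℂ where
  toFun f := fun m => coeff (m + Finsupp.single i k) f
  map_add' _ _ := rfl
  map_smul' _ _ := rfl

@[simp] theorem coeff_divXPow (i : σ) (k : ℕ) (f : MvPowerSeries σ ℂ) (m : σ →₀ ℕ) :
    coeff m (divXPow i k f) = coeff (m + Finsupp.single i k) f := rfl

theorem wnorm_divXPow_le (ρ : σ → ℝ≥0) (i : σ) (k : ℕ) (f : MvPowerSeries σ ℂ) :
    wnorm ρ (divXPow i k f) * (ρ i : ℝ≥0∞) ^ k ≤ wnorm ρ f := by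
  rw [wnorm, ← ENNReal.tsum_mul_right]
  have : ∀ m, ‖coeff m (divXPow i k f)‖ₑ * polyradiusPow ρ m * (ρ i : ℝ≥0∞) ^ k =
      ‖coeff (m + Finsupp.single i k) f‖ₑ * polyradiusPow ρ (m + Finsupp.single i k) := by
    intro m
    rw [polyradiusPow_add, polyradiusPow_single, coeff_divXPow]
    push_cast
    ring
  simp_rw [this]
  exact ENNReal.tsum_comp_le_tsum_of_injective (add_left_injective _)
    fun m => ‖coeff m f‖ₑ * (polyradiusPow ρ m : ℝ≥0∞)

theorem isConvergentSeries_divXPow {f : MvPowerSeries σ ℂ} (i : σ) (k : ℕ)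
    (hf : IsConvergentSeries f) : IsConvergentSeries (divXPow i k f) := by
  obtain ⟨r, hr, h⟩ := isConvergentSeries_iff_const.mp hf
  refine isConvergentSeries_iff_const.mpr ⟨r, hr, fun h1 => h ?_⟩
  have := wnorm_divXPow_le (fun _ => r) i k f
  rw [h1, ENNReal.top_mul (by simp [hr.ne'])] at this
  exact top_le_iff.mp this

/-- The source of all shrinking factors for polydiscs; `c ≤ 1` ensures that bounds on the larger
polydisc survive. -/
theorem _root_.ENNReal.exists_pos_le_one_mul_le {a ε : ℝ≥0∞} (ha : a ≠ ⊤) (hε : ε ≠ 0) :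
    ∃ c : ℝ≥0, 0 < c ∧ c ≤ 1 ∧ c * a ≤ ε := by
  obtain ⟨n, hn, h⟩ := ENNReal.exists_nnreal_pos_mul_lt ha hε
  exact ⟨min n 1, lt_min hn one_pos, min_le_right _ _,
    (mul_le_mul_left (by exact_mod_cast min_le_left n 1) _).trans h.le⟩

/-- If the `a i` map the polydisc `ρ` into the polydisc `ρ'`, submultiplicativity bounds the norm of
each substituted monomial by its value at `ρ'`; then sum over the monomials. -/
theorem wnorm_subst_le [Finite σ] {a : σ → MvPowerSeries τ ℂ} (ha : ∀ i, constantCoeff (a i) = 0)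
    {ρ : τ → ℝ≥0} {ρ' : σ → ℝ≥0} (h : ∀ i, wnorm ρ (a i) ≤ ρ' i) (f : MvPowerSeries σ ℂ) :
    wnorm ρ (subst a f) ≤ wnorm ρ' f := by
  have hs : HasSubst a := hasSubst_of_constantCoeff_zero ha
  calc wnorm ρ (subst a f)
      ≤ ∑' d : σ →₀ ℕ, wnorm ρ (coeff d f • d.prod fun s e => a s ^ e) := by
        refine wnorm_le_tsum ρ fun m => ?_
        rw [coeff_subst hs, ← tsum_eq_finsum (L := .unconditional _)
          (coeff_subst_finite hs f m)]
        simpa using enorm_tsum_le_tsum_enorm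
          (f := fun d : σ →₀ ℕ => coeff d f • coeff m (d.prod fun s e => a s ^ e))
    _ ≤ wnorm ρ' f := by
        refine ENNReal.tsum_le_tsum fun d => ?_
        rw [wnorm_smul]
        gcongr
        rw [polyradiusPow, Finsupp.prod, Finsupp.prod]
        push_cast
        exact (wnorm_prod_le _ _ _).trans (Finset.prod_le_prod' fun i _ =>
          (wnorm_pow_le _ _ _).trans (pow_le_pow_left' (h i) _))

theorem exists_common_radius {ι : Type*} (s : Finset ι) {a : ι → MvPowerSeries τ ℂ}
    (ha : ∀ i ∈ s, IsConvergentSeries (a i)) :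
    ∃ r : ℝ≥0, 0 < r ∧ ∀ i ∈ s, wnorm (fun _ => r) (a i) ≠ ⊤ := by
  classical
  induction s using Finset.induction_on with
  | empty => exact ⟨1, one_pos, by simp⟩
  | insert i s hi ih =>
    obtain ⟨r, hr, h⟩ := ih fun j hj => ha j (Finset.mem_insert_of_mem hj)
    obtain ⟨r', hr', h'⟩ := isConvergentSeries_iff_const.mp (ha i (Finset.mem_insert_self _ _))
    refine ⟨min r r', lt_min hr hr', fun j hj => ?_⟩
    rcases Finset.mem_insert.mp hj with rfl | hj
    · exact ne_top_of_le_ne_top h' (wnorm_mono (fun _ => min_le_right _ _) _)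
    · exact ne_top_of_le_ne_top (h j hj) (wnorm_mono (fun _ => min_le_left _ _) _)

/-- Since the `a i` have no constant term, their norms tend to zero with the polydisc, so a small
enough one is mapped into the domain of `f`. -/
theorem isConvergentSeries_subst [Finite σ] {a : σ → MvPowerSeries τ ℂ}
    (ha : ∀ i, constantCoeff (a i) = 0) (ha' : ∀ i, IsConvergentSeries (a i))
    {f : MvPowerSeries σ ℂ} (hf : IsConvergentSeries f) : IsConvergentSeries (subst a f) := by
  cases nonempty_fintype σ
  obtain ⟨r, hr, hrf⟩ := isConvergentSeries_iff_const.mp hf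
  obtain ⟨s, hs, hsa⟩ := exists_common_radius Finset.univ fun i _ => ha' i
  obtain ⟨c, hc, hc1, hcr⟩ := ENNReal.exists_pos_le_one_mul_le
    (a := ∑ i, wnorm (fun _ => s) (a i)) (ε := r) (ENNReal.sum_ne_top.mpr hsa)
        (by simpa using hr.ne')
  refine isConvergentSeries_iff_const.mpr ⟨c * s, mul_pos hc hs, ne_top_of_le_ne_top hrf
    (wnorm_subst_le ha (fun i => ?_) f)⟩
  calc wnorm (c • fun _ => s) (a i) ≤ c * wnorm (fun _ => s) (a i) :=
        wnorm_smul_le_of_constantCoeff_eq_zero (ha i) hc1 _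
    _ ≤ c * ∑ i, wnorm (fun _ => s) (a i) := by
        gcongr
        exact Finset.single_le_sum (f := fun i => wnorm (fun _ => s) (a i)) (by simp)
          (Finset.mem_univ i)
    _ ≤ r := hcr

theorem isConvergentSeries_monomial (n : σ →₀ ℕ) (c : ℂ) : IsConvergentSeries (monomial n c) :=
  isConvergentSeries_iff_const.mpr ⟨1, one_pos, by
    rw [wnorm_monomial]; exact ENNReal.mul_ne_top (by simp) (by simp)⟩

end MvPowerSeries

/-! ### The ring of convergent series and its substitution homomorphisms -/

namespace convergentSeries

open MvPowerSeries

variable {σ τ : Type*}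

instance : IsDomain (convergentSeries σ) :=
  have : IsDomain (MvPowerSeries σ ℂ) := NoZeroDivisors.to_isDomain _
  Function.Injective.isDomain (convergentSeries σ).val.toRingHom Subtype.val_injective

/-- The coordinate functions. -/
noncomputable def X (i : σ) : convergentSeries σ := ⟨MvPowerSeries.X i,
    isConvergentSeries_monomial _ _⟩

@[simp] theorem coe_X (i : σ) : ((X i : convergentSeries σ) : MvPowerSeries σ ℂ) =
    MvPowerSeries.X i := rfl

/-- The value at the origin. -/
noncomputable def eval₀ (σ : Type*) : convergentSeries σ →ₐ[ℂ] ℂ :=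
  { (MvPowerSeries.constantCoeff (σ := σ) (R := ℂ)).comp
      (convergentSeries σ).val.toRingHom with
    commutes' := fun c => by
      change MvPowerSeries.constantCoeff (algebraMap ℂ (MvPowerSeries σ ℂ) c) = c
      simp [MvPowerSeries.algebraMap_apply] }

theorem eval₀_apply (f : convergentSeries σ) :
    eval₀ σ f = MvPowerSeries.constantCoeff (f : MvPowerSeries σ ℂ) := rfl

@[simp] theorem eval₀_X (i : σ) : eval₀ σ (X i) = 0 := by
  simp [eval₀_apply]

/-- Substitution of convergent series without constant terms into convergent series. -/
noncomputable def subst [Finite σ] (a : σ → convergentSeries τ) (ha : ∀ i, eval₀ τ (a i) = 0) :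
    convergentSeries σ →ₐ[ℂ] convergentSeries τ :=
  ((substAlgHom (hasSubst_of_constantCoeff_zero (a := fun i => (a i : MvPowerSeries τ ℂ)) ha)).comp
    (convergentSeries σ).val).codRestrict _ fun f => by
      have := isConvergentSeries_subst ha (fun i => (a i).2) f.2
      rwa [← coe_substAlgHom (hasSubst_of_constantCoeff_zero ha)] at this

theorem coe_subst [Finite σ] (a : σ → convergentSeries τ) (ha : ∀ i, eval₀ τ (a i) = 0)
    (f : convergentSeries σ) : (subst a ha f : MvPowerSeries τ ℂ) =
      MvPowerSeries.subst (fun i => (a i : MvPowerSeries τ ℂ)) (f : MvPowerSeries σ ℂ) := by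
  rw [← coe_substAlgHom (hasSubst_of_constantCoeff_zero ha)]
  rfl

@[simp] theorem subst_X [Finite σ] (a : σ → convergentSeries τ) (ha : ∀ i, eval₀ τ (a i) = 0)
    (i : σ) : subst a ha (X i) = a i := by
  apply Subtype.ext
  rw [coe_subst, coe_X, MvPowerSeries.subst_X (hasSubst_of_constantCoeff_zero ha)]

@[simp] theorem eval₀_subst [Finite σ] (a : σ → convergentSeries τ) (ha : ∀ i, eval₀ τ (a i) = 0)
    (f : convergentSeries σ) : eval₀ τ (subst a ha f) = eval₀ σ f := by
  have h : eval₀ τ (subst a ha (f - algebraMap ℂ _ (eval₀ σ f))) = 0 := by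
    rw [eval₀_apply, coe_subst]
    refine MvPowerSeries.constantCoeff_subst_eq_zero (hasSubst_of_constantCoeff_zero ha) ha ?_
    rw [← eval₀_apply]
    simp
  simpa [sub_eq_zero] using h

theorem subst_subst {υ : Type*} [Finite σ] [Finite τ] (a : σ → convergentSeries τ)
    (ha : ∀ i, eval₀ τ (a i) = 0) (b : τ → convergentSeries υ) (hb : ∀ i, eval₀ υ (b i) = 0)
    (f : convergentSeries σ) :
    subst b hb (subst a ha f) = subst (fun i => subst b hb (a i)) (by simpa using ha) f := by
  apply Subtype.ext
  rw [coe_subst, coe_subst, coe_subst, MvPowerSeries.subst_comp_subst_apply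
    (hasSubst_of_constantCoeff_zero ha) (hasSubst_of_constantCoeff_zero hb)]
  simp_rw [coe_subst]

theorem subst_X_self [Finite σ] (f : convergentSeries σ) : subst X eval₀_X f = f := by
  apply Subtype.ext
  rw [coe_subst]
  exact congrFun MvPowerSeries.subst_self _

end convergentSeries

/-! ### Weierstrass division -/

namespace MvPowerSeries

variable {σ τ : Type*}

/-- The series `f` is regular of order `k` in `Xᵢ`: its restriction to the `i`-th coordinate axis
has order `k`. -/
def IsRegularOfOrder (f : MvPowerSeries σ ℂ) (i : σ) (k : ℕ) : Prop :=
  (∀ j < k, coeff (Finsupp.single i j) f = 0) ∧ coeff (Finsupp.single i k) f ≠ 0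

theorem divXPow_X_pow_mul (i : σ) (k : ℕ) (f : MvPowerSeries σ ℂ) :
    divXPow i k (X i ^ k * f) = f := by
  ext m
  rw [coeff_divXPow, X_pow_eq, add_comm, coeff_add_monomial_mul, one_mul]

/-- Shrinking all radii but the `i`-th gains a factor `c` on every monomial that involves another
variable. This is what makes the low-order part of a regular series small at fixed `ρ i`. -/
theorem polyradiusPow_update_le {ρ : σ → ℝ≥0} {i : σ} [DecidableEq σ] {c : ℝ≥0} (hc : c ≤ 1)
    {m : σ →₀ ℕ} (hm : ∃ j, j ≠ i ∧ m j ≠ 0) :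
    polyradiusPow (fun j => if j = i then ρ j else c * ρ j) m ≤ c * polyradiusPow ρ m := by
  obtain ⟨j, hj, hmj⟩ := hm
  have hle : (fun j => if j = i then ρ j else c * ρ j) ≤ ρ := by
    intro l
    dsimp only
    split_ifs
    · exact le_rfl
    · exact mul_le_of_le_one_left zero_le hc
  have hm : m = (m - Finsupp.single j 1) + Finsupp.single j 1 := by
    rw [tsub_add_cancel_of_le]
    exact Finsupp.single_le_iff.mpr (Nat.one_le_iff_ne_zero.mpr hmj)
  rw [hm, polyradiusPow_add, polyradiusPow_add, polyradiusPow_single, polyradiusPow_single,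
    if_neg hj, pow_one, pow_one, mul_left_comm c]
  gcongr
  exact polyradiusPow_mono hle _

/-- **Weierstrass division** for convergent power series. -/
theorem exists_weierstrass_division [Finite σ] {f g : MvPowerSeries σ ℂ}
    (hf : IsConvergentSeries f) (hg : IsConvergentSeries g) {i : σ} {k : ℕ}
    (hfk : IsRegularOfOrder f i k) :
    ∃ q, IsConvergentSeries q ∧ ∀ m : σ →₀ ℕ, k ≤ m i → coeff m (g - q * f) = 0 := by
  classical
  obtain ⟨hf0, hu0⟩ := hfk
  -- Write `f = P + Xᵢᵏ u` with `u = u₀ (1 - v)`; here `v` has no constant term, and every monomial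
  -- of `P` involves a variable other than `Xᵢ`. The remainder condition says that `divXPow i k`
  -- kills `g - q f`, that is, `q u = divXPow g - divXPow (q P)`. Dividing by `u₀` gives `q = u₀⁻¹
  -- divXPow g + K q` with the `K` below.
  set u := divXPow i k f with hu
  set u₀ := coeff (Finsupp.single i k) f with hu₀
  set v := 1 - u₀⁻¹ • u with hv
  set P := f - X i ^ k * u with hP
  have hv0 : constantCoeff v = 0 := by
    rw [hv, map_sub, map_one, ← coeff_zero_eq_constantCoeff_apply, coeff_smul, hu, coeff_divXPow,
      zero_add, ← hu₀]
    simp [inv_mul_cancel₀ hu0]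
  have hucv : IsConvergentSeries u := isConvergentSeries_divXPow i k hf
  have hvcv : IsConvergentSeries v :=
    sub_mem (one_mem (convergentSeries σ)) (Subalgebra.smul_mem (convergentSeries σ) hucv _)
  have hXk : IsConvergentSeries (X i ^ k : MvPowerSeries σ ℂ) := by
    rw [X_pow_eq]; exact isConvergentSeries_monomial _ _
  have hPcv : IsConvergentSeries P :=
    sub_mem (show f ∈ convergentSeries σ from hf) (hXk.mul hucv)
  have hPcoeff : ∀ m, (∀ j, j ≠ i → m j = 0) → coeff m P = 0 := by
    intro m hm
    have hm' : m = Finsupp.single i (m i) := by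
      ext j
      by_cases hj : j = i
      · subst hj; simp
      · rw [hm j hj, Finsupp.single_eq_of_ne hj]
    rw [hm', hP, map_sub, X_pow_eq, coeff_monomial_mul]
    by_cases hk : k ≤ m i
    · rw [if_pos (by simpa using hk), hu, coeff_divXPow, ← Finsupp.single_tsub,
        ← Finsupp.single_add, tsub_add_cancel_of_le hk]
      simp
    · rw [if_neg (by simpa using hk), hf0 _ (not_le.mp hk), sub_zero]
  obtain ⟨r, hr, hrs⟩ := exists_common_radius (τ := σ) Finset.univ
    (a := ![g, v, P]) (fun l _ => by fin_cases l <;> assumption)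
  have hgr : wnorm (fun _ => r) g ≠ ⊤ := hrs 0 (Finset.mem_univ _)
  have hvr : wnorm (fun _ => r) v ≠ ⊤ := hrs 1 (Finset.mem_univ _)
  have hPr : wnorm (fun _ => r) P ≠ ⊤ := hrs 2 (Finset.mem_univ _)
  -- The order of choices matters: first a common radius `s` making `v` small, then `c₂` shrinking
  -- only the other variables. The second step makes `P` small while the cost `s⁻ᵏ` of dividing by
  -- `Xᵢᵏ` stays fixed. Each half of `K` then has norm at most `1/4`.
  obtain ⟨c₁, hc₁, hc₁1, hc₁v⟩ := ENNReal.exists_pos_le_one_mul_le (ε := 4⁻¹) hvr (by simp)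
  set s : ℝ≥0 := c₁ * r with hs
  have hs0 : 0 < s := mul_pos hc₁ hr
  have hsr : s ≤ r := mul_le_of_le_one_left zero_le hc₁1
  have hvs : wnorm (fun _ => s) v ≤ 4⁻¹ :=
    (wnorm_smul_le_of_constantCoeff_eq_zero hv0 hc₁1 (fun _ => r)).trans hc₁v
  have hPs : wnorm (fun _ => s) P ≠ ⊤ := ne_top_of_le_ne_top hPr (wnorm_mono (fun _ => hsr) _)
  obtain ⟨c₂, hc₂, hc₂1, hc₂P⟩ := ENNReal.exists_pos_le_one_mul_le (ε := 4⁻¹)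
    (a := ‖u₀⁻¹‖ₑ * ((s : ℝ≥0∞) ^ k)⁻¹ * wnorm (fun _ => s) P)
    (ENNReal.mul_ne_top (ENNReal.mul_ne_top (by simp) (by simp [hs0.ne'])) hPs) (by simp)
  set ρ : σ → ℝ≥0 := fun j => if j = i then s else c₂ * s with hρdef
  have hρ : ∀ j, 0 < ρ j := by
    intro j
    simp only [hρdef]
    split_ifs
    · exact hs0
    · exact mul_pos hc₂ hs0
  have hρs : ρ ≤ fun _ => s := by
    intro j
    simp only [hρdef]
    split_ifs
    · exact le_rfl
    · exact mul_le_of_le_one_left zero_le hc₂1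
  have hρi : ρ i = s := by simp [hρdef]
  have hPρ : wnorm ρ P ≤ c₂ * wnorm (fun _ => s) P := by
    rw [wnorm, wnorm, ← ENNReal.tsum_mul_left]
    refine ENNReal.tsum_le_tsum fun m => ?_
    by_cases hm : ∃ j, j ≠ i ∧ m j ≠ 0
    · rw [mul_left_comm]
      gcongr
      exact_mod_cast polyradiusPow_update_le (ρ := fun _ => s) hc₂1 hm
    · push Not at hm
      simp [hPcoeff m hm]
  have hdiv : ∀ h, wnorm ρ (divXPow i k h) ≤ ((s : ℝ≥0∞) ^ k)⁻¹ * wnorm ρ h := by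
    intro h
    rw [mul_comm, ← div_eq_mul_inv,
      ENNReal.le_div_iff_mul_le (Or.inl (by simp [hs0.ne'])) (Or.inl (by simp))]
    have := wnorm_divXPow_le ρ i k h
    rwa [hρi] at this
  let K : MvPowerSeries σ ℂ →ₗ[ℂ] MvPowerSeries σ ℂ :=
    -(u₀⁻¹ • (divXPow i k ∘ₗ LinearMap.mulRight ℂ P)) + LinearMap.mulRight ℂ v
  have hKapp : ∀ q, K q = -(u₀⁻¹ • divXPow i k (q * P)) + q * v := fun q => rfl
  have hK : ∀ q, wnorm ρ (K q) ≤ (4⁻¹ + 4⁻¹) * wnorm ρ q := by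
    intro q
    rw [hKapp, add_mul]
    refine (wnorm_add_le _ _ _).trans (add_le_add ?_ ?_)
    · rw [wnorm_neg, wnorm_smul]
      calc ‖u₀⁻¹‖ₑ * wnorm ρ (divXPow i k (q * P))
          ≤ ‖u₀⁻¹‖ₑ * (((s : ℝ≥0∞) ^ k)⁻¹ * (wnorm ρ q * (c₂ * wnorm (fun _ => s) P))) := by
            gcongr
            refine (hdiv _).trans ?_
            gcongr
            exact (wnorm_mul_le _ _ _).trans (by gcongr)
        _ = c₂ * (‖u₀⁻¹‖ₑ * ((s : ℝ≥0∞) ^ k)⁻¹ * wnorm (fun _ => s) P) * wnorm ρ q := by ring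
        _ ≤ 4⁻¹ * wnorm ρ q := by gcongr
    · refine (wnorm_mul_le _ _ _).trans ?_
      rw [mul_comm]
      gcongr
      exact (wnorm_mono hρs _).trans hvs
  have hc : (4⁻¹ + 4⁻¹ : ℝ≥0∞) < 1 := by
    have : (4⁻¹ + 4⁻¹ : ℝ≥0∞) = ((4⁻¹ + 4⁻¹ : ℝ≥0) : ℝ≥0∞) := by
      push_cast; rfl
    rw [this]
    exact_mod_cast (by norm_num : (4⁻¹ + 4⁻¹ : ℝ≥0) < 1)
  obtain ⟨q, hq, hqK⟩ := exists_eq_add_of_contracting hρ K hc hK (u₀⁻¹ • divXPow i k g) (by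
    rw [wnorm_smul]
    refine ENNReal.mul_ne_top (by simp) (ne_top_of_le_ne_top ?_ (hdiv g))
    exact ENNReal.mul_ne_top (by simp [hs0.ne']) (ne_top_of_le_ne_top hgr
      (wnorm_mono (hρs.trans fun _ => hsr) _)))
  refine ⟨q, isConvergentSeries_of_wnorm_ne_top hρ hq, fun m hm => ?_⟩
  have hqf : divXPow i k (q * f) = divXPow i k (q * P) + q * u := by
    have : q * f = q * P + X i ^ k * (q * u) := by rw [hP]; ring
    rw [this, map_add, divXPow_X_pow_mul]
  have huv : u = u₀ • (1 - v) := by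
    rw [hv, sub_sub_cancel, smul_smul, mul_inv_cancel₀ hu0, one_smul]
  have hqu : q * u = divXPow i k g - divXPow i k (q * P) := by
    have h1 : q * u = u₀ • (q - q * v) := by
      rw [huv, mul_smul_comm, mul_sub, mul_one]
    have h2 : q - q * v = u₀⁻¹ • (divXPow i k g - divXPow i k (q * P)) := by
      rw [sub_eq_iff_eq_add, smul_sub]
      exact hqK.trans (by rw [hKapp]; abel)
    rw [h1, h2, smul_smul, mul_inv_cancel₀ hu0, one_smul]
  have hT : divXPow i k (g - q * f) = 0 := by
    rw [map_sub, hqf, hqu]; abel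
  have := congrArg (coeff (m - Finsupp.single i k)) hT
  rwa [coeff_divXPow, tsub_add_cancel_of_le (by simpa using hm)] at this

end MvPowerSeries

/-! ### Units, locality, and division with polynomial remainder -/

namespace convergentSeries

open MvPowerSeries

variable {σ τ : Type*}

/-- Such an `f` is regular of order `0` in any variable, so dividing `1` by `f` leaves no remainder.
Without variables the ring is `ℂ`. -/
theorem isUnit_of_eval₀_ne_zero [Finite σ] {f : convergentSeries σ} (hf : eval₀ σ f ≠ 0) :
    IsUnit f := by
  by_cases hσ : Nonempty σ
  · obtain ⟨i⟩ := hσ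
    obtain ⟨q, hq, h⟩ := exists_weierstrass_division f.2 (one_mem (convergentSeries σ))
      (i := i) (k := 0) ⟨by simp, by simpa [eval₀_apply] using hf⟩
    refine IsUnit.of_mul_eq_one ⟨q, hq⟩ (Subtype.ext ?_)
    have h2 : 1 - q * (f : MvPowerSeries σ ℂ) = 0 := by
      ext m
      simpa using h m (Nat.zero_le _)
    rw [mul_comm]
    exact (sub_eq_zero.mp h2).symm
  · have hσ' : IsEmpty σ := not_nonempty_iff.mp hσ
    have : f = algebraMap ℂ _ (eval₀ σ f) := by
      apply Subtype.ext
      ext m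
      have hm : m = 0 := Subsingleton.elim _ _
      subst hm
      simp [eval₀_apply, MvPowerSeries.algebraMap_apply]
    rw [this]
    exact (IsUnit.mk0 _ hf).map _

/-- Otherwise `f - (φ f)(0)` would be a unit whose image under `φ` vanishes at the origin. Hence
every `ℂ`-algebra homomorphism here is local, and locality can be ignored until the end. -/
theorem eval₀_algHom [Finite σ] (φ : convergentSeries σ →ₐ[ℂ] convergentSeries τ)
    (f : convergentSeries σ) : eval₀ τ (φ f) = eval₀ σ f := by
  by_contra h
  have hu : IsUnit (f - algebraMap ℂ _ (eval₀ τ (φ f))) :=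
    isUnit_of_eval₀_ne_zero (by simpa [sub_eq_zero] using Ne.symm h)
  have := ((hu.map φ).map (eval₀ τ)).ne_zero
  simp at this

theorem isLocalHom_algHom [Finite σ] (φ : convergentSeries σ →ₐ[ℂ] convergentSeries τ) :
    IsLocalHom φ :=
  ⟨fun f hf => isUnit_of_eval₀_ne_zero (by
    rw [← eval₀_algHom φ]; exact (hf.map (eval₀ τ)).ne_zero)⟩

theorem X_ne_zero (i : σ) : (X i : convergentSeries σ) ≠ 0 := fun h => by
  classical
  simpa using congrArg (coeff (Finsupp.single i 1)) (congrArg Subtype.val h)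

/-- Series in the variables `τ`, seen as series in the variables `Option τ`. -/
noncomputable def incl (τ : Type*) [Finite τ] :
    convergentSeries τ →ₐ[ℂ] convergentSeries (Option τ) :=
  subst (fun i => X (some i)) fun _ => eval₀_X _

theorem coeff_incl [Finite τ] (f : convergentSeries τ) (m : Option τ →₀ ℕ) :
    coeff m (incl τ f : MvPowerSeries (Option τ) ℂ) =
      if m none = 0 then coeff m.some (f : MvPowerSeries τ ℂ) else 0 := by
  have h : (incl τ f : MvPowerSeries (Option τ) ℂ) =
      rename (Function.Embedding.some (α := τ)) (f : MvPowerSeries τ ℂ) := by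
    rw [incl, coe_subst, rename_eq_subst]
    rfl
  rw [h]
  split_ifs with hm
  · have : m = m.some.embDomain Function.Embedding.some := by
      ext (_ | i)
      · rw [hm, Finsupp.embDomain_some_none]
      · rw [Finsupp.embDomain_some_some, Finsupp.some_apply]
    conv_lhs => rw [this]
    rw [coeff_embDomain_rename]
  · refine coeff_rename_eq_zero _ _ ?_
    rintro ⟨n, rfl⟩
    exact hm (Finsupp.mapDomain_of_notMem_range _ _ (by simp))

/-- The coefficient of the `j`-th power of the last variable. -/
noncomputable def coeffNone (f : MvPowerSeries (Option τ) ℂ) (j : ℕ) : MvPowerSeries τ ℂ :=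
  fun n => coeff (n.embDomain Function.Embedding.some + Finsupp.single none j) f

theorem coeff_coeffNone (f : MvPowerSeries (Option τ) ℂ) (j : ℕ) (n : τ →₀ ℕ) :
    coeff n (coeffNone f j) =
      coeff (n.embDomain Function.Embedding.some + Finsupp.single none j) f := rfl

theorem isConvergentSeries_coeffNone {f : MvPowerSeries (Option τ) ℂ}
    (hf : IsConvergentSeries f) (j : ℕ) :
    IsConvergentSeries (coeffNone f j) := by
  obtain ⟨r, hr, h⟩ := isConvergentSeries_iff_const.mp hf
  refine isConvergentSeries_iff_const.mpr ⟨r, hr, fun htop => h ?_⟩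
  have hinj : Function.Injective fun n : τ →₀ ℕ =>
      n.embDomain Function.Embedding.some + Finsupp.single none j := fun a b hab =>
    Finsupp.embDomain_injective _ (add_right_cancel hab)
  have key : wnorm (fun _ => r) (coeffNone f j) * (r : ℝ≥0∞) ^ j ≤ wnorm (fun _ => r) f := by
    rw [wnorm, ← ENNReal.tsum_mul_right]
    refine le_trans (le_of_eq ?_) (ENNReal.tsum_comp_le_tsum_of_injective hinj
      fun m => ‖coeff m f‖ₑ * (polyradiusPow (fun _ => r) m : ℝ≥0∞))
    refine tsum_congr fun n => ?_
    rw [polyradiusPow_add, polyradiusPow_single, polyradiusPow, polyradiusPow,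
      Finsupp.prod_embDomain]
    push_cast
    rw [mul_assoc, coeff_coeffNone]
  rw [htop, ENNReal.top_mul (by simp [hr.ne'])] at key
  exact top_le_iff.mp key

theorem exists_weierstrass_division_polynomial [Finite τ] {f : convergentSeries (Option τ)} {k : ℕ}
    (hf : IsRegularOfOrder (f : MvPowerSeries (Option τ) ℂ) none k)
    (g : convergentSeries (Option τ)) :
    ∃ (q : convergentSeries (Option τ)) (R : Polynomial (convergentSeries τ)), R.degree < k ∧
      g = q * f + R.eval₂ (incl τ) (X none) := by
  classical
  obtain ⟨q, hq, h⟩ := exists_weierstrass_division f.2 g.2 hf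
  set S : convergentSeries (Option τ) := g - ⟨q, hq⟩ * f with hS
  let r : ℕ → convergentSeries τ := fun j => ⟨_, isConvergentSeries_coeffNone S.2 j⟩
  refine ⟨⟨q, hq⟩, ∑ j ∈ Finset.range k, Polynomial.monomial j (r j), ?_, ?_⟩
  · rw [← Polynomial.mem_degreeLT]
    refine Submodule.sum_mem _ fun j hj => Polynomial.mem_degreeLT.mpr ?_
    exact (Polynomial.degree_monomial_le _ _).trans_lt (by simpa using hj)
  · rw [← sub_eq_iff_eq_add', ← hS, Polynomial.eval₂_finsetSum]
    simp_rw [Polynomial.eval₂_monomial]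
    apply Subtype.ext
    ext m
    have hterm : ∀ j, coeff m ((incl τ (r j) * X none ^ j : convergentSeries (Option τ)) :
        MvPowerSeries (Option τ) ℂ) = if j = m none then coeff m S.1 else 0 := by
      intro j
      rw [Subalgebra.coe_mul, Subalgebra.coe_pow, coe_X, X_pow_eq, coeff_mul_monomial, mul_one,
        coeff_incl]
      simp only [Finsupp.single_le_iff, Finsupp.coe_tsub, Pi.sub_apply, Finsupp.single_eq_same]
      rcases lt_trichotomy j (m none) with hj | rfl | hj
      · rw [if_pos hj.le, if_neg (by omega), if_neg (by omega)]
      · rw [if_pos le_rfl, if_pos (by omega), if_pos rfl]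
        rw [coeff_coeffNone]
        congr 2
        ext (_ | i)
        · rw [Finsupp.add_apply, Finsupp.embDomain_some_none, Finsupp.single_eq_same, zero_add]
        · rw [Finsupp.add_apply, Finsupp.embDomain_some_some]
          simp
      · rw [if_neg (by omega), if_neg (by omega)]
    have hsum : coeff m ((∑ j ∈ Finset.range k, incl τ (r j) * X none ^ j :
        convergentSeries (Option τ)) : MvPowerSeries (Option τ) ℂ) =
        ∑ j ∈ Finset.range k, if j = m none then coeff m S.1 else 0 := by
      rw [AddSubmonoidClass.coe_finsetSum, map_sum]
      exact Finset.sum_congr rfl fun j _ => hterm j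
    refine Eq.trans ?_ hsum.symm
    rw [Finset.sum_ite_eq']
    split_ifs with hm
    · rfl
    · exact h m (by simpa using hm)

/-! ### Restriction to lines, and regularity after a linear change of coordinates -/

/-- The restriction of a series to the line through the point `c`. -/
noncomputable def line [Finite σ] (c : σ → ℂ) : convergentSeries σ →ₐ[ℂ] convergentSeries Unit :=
  subst (fun i => c i • X ()) (by simp)

/-- The monomial `zᵐ` restricts to its value at `c` times a power of `t` with exponent `m.degree`,
so the coefficient is the homogeneous part of degree `d` evaluated at `c`. -/
theorem coeff_line [Finite σ] (c : σ → ℂ) (f : convergentSeries σ) (d : ℕ) :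
    coeff (Finsupp.single () d) (line c f : MvPowerSeries Unit ℂ) =
      ∑ᶠ m : σ →₀ ℕ, if m.degree = d then
        coeff m (f : MvPowerSeries σ ℂ) * m.prod fun i k => c i ^ k else 0 := by
  classical
  rw [line, coe_subst, MvPowerSeries.coeff_subst (hasSubst_of_constantCoeff_zero (by simp))]
  refine finsum_congr fun m => ?_
  have : (m.prod fun i k => ((c i • X () : convergentSeries Unit) : MvPowerSeries Unit ℂ) ^ k) =
      monomial (Finsupp.single () m.degree) (m.prod fun i k => c i ^ k) := by
    have h1 : ∀ (i : σ) (k : ℕ), ((c i • X () : convergentSeries Unit) : MvPowerSeries Unit ℂ) ^ k =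
        C (c i ^ k) * MvPowerSeries.X () ^ k := by
      intro i k
      rw [Subalgebra.coe_smul, coe_X, smul_eq_C_mul, mul_pow, map_pow]
    simp_rw [h1]
    rw [Finsupp.prod_mul, Finsupp.prod, Finsupp.prod, ← map_prod, Finset.prod_pow_eq_pow_sum,
      ← Finsupp.degree_apply, X_pow_eq, ← smul_eq_C_mul, ← LinearMap.map_smul]
    simp [Finsupp.prod]
  rw [this, coeff_monomial]
  by_cases hd : m.degree = d
  · simp [hd]
  · rw [if_neg hd, if_neg, smul_zero]
    intro h
    exact hd (by simpa using (DFunLike.congr_fun h ()).symm)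

/-- Some homogeneous part of `f` is a nonzero polynomial, hence nonzero at some `c` because `ℂ` is
infinite. -/
theorem exists_line_ne_zero [Finite σ] {f : convergentSeries σ} (hf : f ≠ 0) :
    ∃ c : σ → ℂ, line c f ≠ 0 := by
  classical
  cases nonempty_fintype σ
  obtain ⟨m, hm⟩ : ∃ m, coeff m (f : MvPowerSeries σ ℂ) ≠ 0 := by
    by_contra! h
    exact hf (Subtype.ext (MvPowerSeries.ext h))
  have hfin : {n : σ →₀ ℕ | n.degree = m.degree}.Finite :=
    (Finsupp.finite_of_degree_le (σ := σ) m.degree).subset fun n hn => le_of_eq hn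
  let p : MvPolynomial σ ℂ := ∑ n ∈ hfin.toFinset,
    MvPolynomial.monomial n (coeff n (f : MvPowerSeries σ ℂ))
  have hp : p ≠ 0 := by
    intro h0
    have : MvPolynomial.coeff m p = coeff m (f : MvPowerSeries σ ℂ) := by
      rw [MvPolynomial.coeff_sum, Finset.sum_eq_single m]
      · simp
      · intro n _ hn
        simp [MvPolynomial.coeff_monomial, hn]
      · intro h
        simp at h
    rw [h0] at this
    exact hm (by simpa using this.symm)
  obtain ⟨c, hc⟩ : ∃ c, MvPolynomial.eval c p ≠ 0 := by
    by_contra! h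
    exact hp (MvPolynomial.funext fun x => by simpa using h x)
  refine ⟨c, fun h0 => hc ?_⟩
  have h1 := coeff_line c f m.degree
  rw [h0] at h1
  rw [map_sum]
  simp_rw [MvPolynomial.eval_monomial]
  rw [finsum_eq_sum_of_support_subset (s := hfin.toFinset)] at h1
  · refine Eq.trans (Finset.sum_congr rfl fun n hn => ?_) h1.symm
    rw [if_pos (by simpa using hn)]
  · intro n hn
    simp only [Function.mem_support, ne_eq, ite_eq_right_iff, not_forall] at hn
    simpa using hn.1

/-- The restriction of a series to a coordinate axis. -/
noncomputable abbrev axis [Finite σ] [DecidableEq σ] (i : σ) :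
    convergentSeries σ →ₐ[ℂ] convergentSeries Unit :=
  line (Pi.single i 1)

theorem coeff_axis [Finite σ] [DecidableEq σ] (i : σ) (f : convergentSeries σ) (d : ℕ) :
    coeff (Finsupp.single () d) (axis i f : MvPowerSeries Unit ℂ) =
      coeff (Finsupp.single i d) (f : MvPowerSeries σ ℂ) := by
  rw [coeff_line, finsum_eq_single _ (Finsupp.single i d)]
  · simp
  · intro m hm
    split_ifs with hd
    · obtain ⟨j, hj, hmj⟩ : ∃ j, j ≠ i ∧ m j ≠ 0 := by
        by_contra! h
        have h2 : m = Finsupp.single i (m i) := by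
          ext j
          by_cases hj : j = i
          · subst hj; simp
          · rw [h j hj, Finsupp.single_eq_of_ne hj]
        rw [h2, Finsupp.degree_single] at hd
        exact hm (by rw [h2, hd])
      rw [Finsupp.prod, Finset.prod_eq_zero (i := j) (by simpa using hmj), mul_zero]
      rw [Pi.single_eq_of_ne hj, zero_pow hmj]
    · rfl

theorem isRegularOfOrder_axis_iff [Finite σ] [DecidableEq σ] {i : σ} {f : convergentSeries σ}
    {k : ℕ} : IsRegularOfOrder (axis i f : MvPowerSeries Unit ℂ) () k ↔
      IsRegularOfOrder (f : MvPowerSeries σ ℂ) i k := by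
  simp only [IsRegularOfOrder, coeff_axis]

theorem exists_isRegularOfOrder {f : convergentSeries Unit} (hf : f ≠ 0) :
    ∃ k, IsRegularOfOrder (f : MvPowerSeries Unit ℂ) () k := by
  classical
  have h : ∃ k, coeff (Finsupp.single () k) (f : MvPowerSeries Unit ℂ) ≠ 0 := by
    by_contra! h
    refine hf (Subtype.ext (MvPowerSeries.ext fun m => ?_))
    rw [Finsupp.unique_single m]
    exact h _
  exact ⟨Nat.find h, fun j hj => not_not.mp (Nat.find_min h hj), Nat.find_spec h⟩

theorem isRegularOfOrder_iff {f : convergentSeries Unit} {k : ℕ} :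
    IsRegularOfOrder (f : MvPowerSeries Unit ℂ) () k ↔
      ∃ b : convergentSeries Unit, eval₀ _ b ≠ 0 ∧ f = X () ^ k * b := by
  classical
  constructor
  · rintro ⟨h0, h1⟩
    refine ⟨⟨divXPow () k f, isConvergentSeries_divXPow _ _ f.2⟩, ?_, Subtype.ext ?_⟩
    · rw [eval₀_apply, ← coeff_zero_eq_constantCoeff_apply, coeff_divXPow, zero_add]
      exact h1
    · refine MvPowerSeries.ext fun m => ?_
      rw [Finsupp.unique_single m, Subalgebra.coe_mul, Subalgebra.coe_pow, coe_X, X_pow_eq,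
        coeff_monomial_mul]
      split_ifs with h
      · rw [coeff_divXPow, tsub_add_cancel_of_le h, one_mul]
      · exact h0 _ (by simpa using h)
  · rintro ⟨b, hb, rfl⟩
    refine ⟨fun j hj => ?_, ?_⟩
    · rw [Subalgebra.coe_mul, Subalgebra.coe_pow, coe_X, X_pow_eq, coeff_monomial_mul, if_neg]
      simpa using hj
    · rw [Subalgebra.coe_mul, Subalgebra.coe_pow, coe_X, X_pow_eq, coeff_monomial_mul,
        if_pos le_rfl, tsub_self, one_mul]
      exact hb

theorem line_subst [Finite σ] [Finite τ] (a : σ → convergentSeries τ)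
    (ha : ∀ i, eval₀ τ (a i) = 0) (c : τ → ℂ) (f : convergentSeries σ) :
    line c (subst a ha f) = subst (fun i => line c (a i)) (by simp [line, ha]) f :=
  subst_subst _ _ _ _ _

/-- Every nonzero series becomes regular in the last variable after a linear change of
coordinates. -/
theorem exists_linear_change [Finite τ] {f : convergentSeries (Option τ)} (hf : f ≠ 0) :
    ∃ α β : convergentSeries (Option τ) →ₐ[ℂ] convergentSeries (Option τ),
      (∀ x, β (α x) = x) ∧
      ∃ k, IsRegularOfOrder (α f : MvPowerSeries (Option τ) ℂ) none k := by
  classical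
  -- The extra factor `X none` forces `c none ≠ 0`, so that the linear map taking the last axis to
  -- the line through `c` is invertible.
  obtain ⟨c, hc⟩ := exists_line_ne_zero (mul_ne_zero hf (X_ne_zero none))
  rw [map_mul, mul_ne_zero_iff] at hc
  obtain ⟨hcf, hc0⟩ := hc
  have hc0 : c none ≠ 0 := by
    intro h
    simp [line, h] at hc0
  let a : Option τ → convergentSeries (Option τ) := fun i =>
    i.elim (c none • X none) fun i => X (some i) + c (some i) • X none
  have ha : ∀ i, eval₀ _ (a i) = 0 := by rintro (_ | i) <;> simp [a]
  let b : Option τ → convergentSeries (Option τ) := fun i =>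
    i.elim ((c none)⁻¹ • X none) fun i => X (some i) - (c (some i) * (c none)⁻¹) • X none
  have hb : ∀ i, eval₀ _ (b i) = 0 := by rintro (_ | i) <;> simp [b]
  refine ⟨subst a ha, subst b hb, fun x => ?_, ?_⟩
  · rw [subst_subst]
    conv_rhs => rw [← subst_X_self x]
    congr 2
    funext i
    rcases i with _ | i
    · simp [a, b, smul_smul, hc0]
    · simp [a, b, smul_smul]
  · have h1 : axis none (subst a ha f) = line c f := by
      rw [line_subst]
      change _ = subst _ _ f
      congr 2
      funext i
      rcases i with _ | i
      · simp [a, line]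
      · simp [a, line]
    obtain ⟨k, hk⟩ := exists_isRegularOfOrder hcf
    exact ⟨k, isRegularOfOrder_axis_iff.mp (h1 ▸ hk)⟩

/-! ### Newton–Puiseux -/

/-- The substitution `t ↦ tᵏ`. -/
noncomputable def ramify (k : ℕ+) : convergentSeries Unit →ₐ[ℂ] convergentSeries Unit :=
  subst (fun _ => X () ^ (k : ℕ)) (by simp)

@[simp] theorem ramify_X (k : ℕ+) : ramify k (X ()) = X () ^ (k : ℕ) := subst_X _ _ _

@[simp] theorem eval₀_ramify (k : ℕ+) (f : convergentSeries Unit) :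
    eval₀ _ (ramify k f) = eval₀ _ f := eval₀_subst _ _ _

theorem ramify_ramify (k l : ℕ+) (f : convergentSeries Unit) :
    ramify l (ramify k f) = ramify (k * l) f := by
  rw [ramify, ramify, subst_subst, ramify]
  congr 2
  funext _
  rw [map_pow, subst_X, ← pow_mul, PNat.mul_coe, mul_comm]

theorem ramify_injective (k : ℕ+) : Function.Injective (ramify k) := by
  rw [injective_iff_map_eq_zero]
  intro f hf
  by_contra hf0
  obtain ⟨v, hv⟩ := exists_isRegularOfOrder hf0
  obtain ⟨b, hb, rfl⟩ := isRegularOfOrder_iff.mp hv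
  rw [map_mul, map_pow, ramify_X, mul_eq_zero] at hf
  rcases hf with hf | hf
  · exact pow_ne_zero _ (pow_ne_zero _ (X_ne_zero ())) hf
  · exact hb (by simpa using congrArg (eval₀ Unit) hf)

theorem subst_eq_algebraMap [Finite σ] {a : σ → convergentSeries τ} (ha : ∀ i, a i = 0)
    (f : convergentSeries σ) :
    subst a (fun i => by simp [ha]) f = algebraMap ℂ _ (eval₀ σ f) := by
  apply Subtype.ext
  have : (fun i => (a i : MvPowerSeries τ ℂ)) = 0 := by
    funext i; rw [ha]; rfl
  rw [coe_subst, this, MvPowerSeries.subst_zero_eq_C_constantCoeff, eval₀_apply]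
  rfl

theorem axis_none_incl [Finite τ] [DecidableEq τ] (f : convergentSeries τ) :
    axis none (incl τ f) = algebraMap ℂ _ (eval₀ τ f) := by
  rw [incl, line_subst]
  exact subst_eq_algebraMap (fun i => by simp [line]) f

@[simp] theorem axis_X [Finite σ] [DecidableEq σ] (i : σ) : axis i (X i) = X () := by
  simp [line]

@[simp] theorem eval₀_line [Finite σ] (c : σ → ℂ) (f : convergentSeries σ) :
    eval₀ _ (line c f) = eval₀ _ f := eval₀_subst _ _ _

theorem coeff_aeval_X (p : Polynomial ℂ) (j : ℕ) :
    coeff (Finsupp.single () j) (Polynomial.aeval (X () : convergentSeries Unit) p).1 =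
      p.coeff j := by
  classical
  induction p using Polynomial.induction_on' with
  | add p q hp hq => rw [map_add, Subalgebra.coe_add, map_add, hp, hq, Polynomial.coeff_add]
  | monomial n a =>
    rw [Polynomial.aeval_monomial, Subalgebra.coe_mul, Subalgebra.coe_pow, coe_X, X_pow_eq,
      Subalgebra.coe_algebraMap, MvPowerSeries.algebraMap_apply, Polynomial.coeff_monomial,
      Algebra.algebraMap_self, RingHom.id_apply, coeff_C_mul, coeff_monomial]
    by_cases h : n = j
    · simp [h]
    · rw [if_neg h, if_neg, mul_zero]
      intro h'
      exact h (by simpa using (DFunLike.congr_fun h' ()).symm)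

theorem eq_zero_of_aeval_X_eq {p : Polynomial ℂ} {e : ℕ} (hp : p.degree < e)
    {z : convergentSeries Unit} (h : Polynomial.aeval (X () : convergentSeries Unit) p = X
        () ^ e * z) :
    p = 0 := by
  classical
  ext j
  rw [Polynomial.coeff_zero]
  by_cases hj : j < e
  · rw [← coeff_aeval_X, h, Subalgebra.coe_mul, Subalgebra.coe_pow, coe_X, X_pow_eq,
      coeff_monomial_mul, if_neg]
    simpa using hj
  · exact Polynomial.coeff_eq_zero_of_degree_lt
      (hp.trans_le (by exact_mod_cast not_lt.mp hj))

theorem natDegree_lt_of_degree_lt {A : Type*} [Semiring A] {p : Polynomial A} {n : ℕ} (hn : n ≠ 0)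
    (h : p.degree < n) : p.natDegree < n := by
  rcases eq_or_ne p 0 with rfl | hp
  · simpa [Nat.pos_iff_ne_zero] using hn
  · exact (Polynomial.natDegree_lt_iff_degree_lt hp).mpr h

/-- Reduction to smaller degree when the value of the polynomial at the origin has a root of
multiplicity less than the degree. -/
theorem exists_root_of_rootMultiplicity_lt {d : ℕ}
    (ih : ∀ e < d, e ≠ 0 → ∀ P : Polynomial (convergentSeries Unit), P.Monic → P.natDegree = e →
      ∃ (k : ℕ+) (η : convergentSeries Unit), P.eval₂ (ramify k :
          ConvSeriesOne →+* ConvSeriesOne) η = 0)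
    {Q : Polynomial (convergentSeries Unit)} (hQ : Q.Monic) {c : ℂ}
    (hc : (Q.map (eval₀ Unit : ConvSeriesOne →+* ℂ)).IsRoot c)
    (he : (Q.map (eval₀ Unit : ConvSeriesOne →+* ℂ)).rootMultiplicity c < d) :
    ∃ (k : ℕ+) (η : convergentSeries Unit), Q.eval₂ (ramify k :
        ConvSeriesOne →+* ConvSeriesOne) η = 0 := by
  classical
  set Q₀ := Q.map (eval₀ Unit : ConvSeriesOne →+* ℂ) with hQ₀
  have hQ₀0 : Q₀ ≠ 0 := (hQ.map _).ne_zero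
  set e := Q₀.rootMultiplicity c with he_def
  have he0 : e ≠ 0 := ((Polynomial.rootMultiplicity_pos hQ₀0).mpr hc).ne'
  obtain ⟨R₀, hR₀, hR₀c⟩ := Polynomial.exists_eq_pow_rootMultiplicity_mul_and_not_dvd Q₀ hQ₀0 c
  rw [Polynomial.dvd_iff_isRoot, Polynomial.IsRoot.def] at hR₀c
  let x : convergentSeries Unit := X () + algebraMap ℂ _ c
  -- `F` is `Q(w + c)` as a series in two variables, `w` being `none` and `t` being `some ()`. At `t
  -- = 0` it is `wᵉ` times a unit, so it is regular of order `e`. Dividing `wᵉ` by it produces the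
  -- Weierstrass polynomial `wᵉ - R = q F`.
  let F : convergentSeries (Option Unit) :=
    Q.eval₂ (incl Unit : ConvSeriesOne →+* convergentSeries (Option Unit))
        (X none + algebraMap ℂ _ c)
  have hincl : ((axis none : convergentSeries (Option Unit) →ₐ[ℂ] convergentSeries Unit) :
        convergentSeries (Option Unit) →+* ConvSeriesOne).comp
      (incl Unit : ConvSeriesOne →+* convergentSeries (Option Unit)) =
      (algebraMap ℂ (convergentSeries Unit)).comp (eval₀ Unit : ConvSeriesOne →+* ℂ) :=
    RingHom.ext fun f => axis_none_incl f
  have hF : axis none F = X () ^ e * Polynomial.aeval x R₀ := by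
    have h1 : axis none F = Polynomial.aeval x Q₀ := by
      have := Polynomial.hom_eval₂ Q (incl Unit : ConvSeriesOne →+* convergentSeries (Option Unit))
        ((axis none : convergentSeries (Option Unit) →ₐ[ℂ] convergentSeries Unit) :
        convergentSeries (Option Unit) →+* ConvSeriesOne)
        (X none + algebraMap ℂ _ c)
      rw [hincl, ← Polynomial.eval₂_map] at this
      refine this.trans ?_
      rw [Polynomial.aeval_def]
      simp [x, hQ₀]
    rw [h1]
    conv_lhs => rw [hR₀]
    simp [x, he_def]
  have hb : eval₀ Unit (Polynomial.aeval x R₀) ≠ 0 := by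
    rw [← Polynomial.aeval_algHom_apply]
    simpa [x] using hR₀c
  have hreg : IsRegularOfOrder (F : MvPowerSeries (Option Unit) ℂ) none e :=
    isRegularOfOrder_axis_iff.mp (isRegularOfOrder_iff.mpr ⟨_, hb, hF⟩)
  obtain ⟨q, R, hRdeg, hqR⟩ := exists_weierstrass_division_polynomial hreg (X none ^ e)
  have haxis : X () ^ e = axis none q * (X () ^ e * Polynomial.aeval x R₀) +
      Polynomial.aeval (X ()) (R.map (eval₀ Unit : ConvSeriesOne →+* ℂ)) := by
    have h1 := congrArg (axis none) hqR
    rw [map_pow, axis_X, map_add, map_mul, hF] at h1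
    have h2 := Polynomial.hom_eval₂ R (incl Unit : ConvSeriesOne →+* convergentSeries (Option Unit))
        ((axis none : convergentSeries (Option Unit) →ₐ[ℂ] convergentSeries Unit) :
        convergentSeries (Option Unit) →+* ConvSeriesOne) (X none)
    rw [hincl, ← Polynomial.eval₂_map] at h2
    refine h1.trans (congrArg _ (h2.trans ?_))
    rw [Polynomial.aeval_def]
    simp
  -- At `t = 0` the remainder has degree less than `e` in `w` but is divisible by `wᵉ`, so it
  -- vanishes. Cancelling `wᵉ` then shows that `q` is nonzero at the origin.
  have hR0 : R.map (eval₀ Unit : ConvSeriesOne →+* ℂ) = 0 :=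
    eq_zero_of_aeval_X_eq (z := 1 - axis none q * Polynomial.aeval x R₀)
      (Polynomial.degree_map_le.trans_lt hRdeg) (by linear_combination -haxis)
  have hq : eval₀ _ q ≠ 0 := by
    rw [hR0, map_zero, add_zero, mul_left_comm] at haxis
    have h1 := mul_left_cancel₀ (pow_ne_zero e (X_ne_zero ())) ((mul_one _).trans haxis)
    have h2 := congrArg (eval₀ Unit) h1
    rw [map_one, map_mul, eval₀_line] at h2
    exact left_ne_zero_of_mul (h2 ▸ one_ne_zero)
  have hWm : (Polynomial.X ^ e - R).Monic := Polynomial.monic_X_pow_sub hRdeg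
  have hWd : (Polynomial.X ^ e - R).natDegree = e := by
    rw [Polynomial.natDegree_sub_eq_left_of_natDegree_lt] <;> rw [Polynomial.natDegree_X_pow]
    exact natDegree_lt_of_degree_lt he0 hRdeg
  obtain ⟨k, η, hη⟩ := ih e he he0 _ hWm hWd
  -- At `t = 0` the Weierstrass polynomial is `wᵉ`, so its root vanishes at the origin and may be
  -- substituted for `w`.
  have hη0 : eval₀ Unit η = 0 := by
    have h1 := Polynomial.hom_eval₂ (Polynomial.X ^ e - R) (ramify k :
        ConvSeriesOne →+* ConvSeriesOne)
      (eval₀ Unit : ConvSeriesOne →+* ℂ) η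
    have h2 : (eval₀ Unit : ConvSeriesOne →+* ℂ).comp (ramify k :
        ConvSeriesOne →+* ConvSeriesOne) = (eval₀ Unit : ConvSeriesOne →+* ℂ) :=
      RingHom.ext fun f => eval₀_ramify k f
    rw [hη, map_zero, h2, ← Polynomial.eval_map, Polynomial.map_sub, hR0] at h1
    simpa [he0] using h1.symm
  let s : convergentSeries (Option Unit) →ₐ[ℂ] convergentSeries Unit :=
    subst (fun i => i.elim η fun _ => X () ^ (k : ℕ)) (by rintro (_ | i) <;> simp [hη0])
  have hs : (s : convergentSeries (Option Unit) →+* ConvSeriesOne).comp (incl Unit :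
      ConvSeriesOne →+* convergentSeries (Option Unit)) =
      (ramify k : ConvSeriesOne →+* ConvSeriesOne) := by
    refine RingHom.ext fun f => ?_
    change s (incl Unit f) = ramify k f
    simp only [s, incl]
    rw [subst_subst, ramify]
    congr 2
    funext i
    rw [subst_X]
    rfl
  have hsX : s (X none) = η := by simp [s]
  have hsqF : s q * s F = 0 := by
    have h1 : q * F = (Polynomial.X ^ e - R).eval₂ (incl Unit :
        ConvSeriesOne →+* convergentSeries (Option Unit)) (X none) := by
      rw [Polynomial.eval₂_sub, Polynomial.eval₂_X_pow]
      linear_combination -hqR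
    have h2 := Polynomial.hom_eval₂ (Polynomial.X ^ e - R)
      (incl Unit : ConvSeriesOne →+* convergentSeries (Option Unit)) (s : convergentSeries
          (Option Unit) →+* ConvSeriesOne) (X none)
    rw [hs, ← h1, RingHom.coe_coe, hsX, hη, map_mul] at h2
    exact h2
  have hsF : s F = 0 := by
    refine (mul_eq_zero.mp hsqF).resolve_left fun h => hq ?_
    rw [← eval₀_algHom s, h, map_zero]
  refine ⟨k, η + algebraMap ℂ _ c, ?_⟩
  have h3 := Polynomial.hom_eval₂ Q (incl Unit : ConvSeriesOne →+* convergentSeries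
      (Option Unit)) (s : convergentSeries (Option Unit) →+* ConvSeriesOne)
    (X none + algebraMap ℂ _ c)
  rw [hs] at h3
  rw [← hsX]
  simpa [hsF, F] using h3.symm

/-- Used for the Tschirnhaus transformation: a suitable `r` kills the coefficient below the leading
one. -/
theorem taylor_coeff_pred {A : Type*} [CommRing A] (P : Polynomial A) (r : A) {n : ℕ}
    (hn : P.natDegree = n + 1) :
    (Polynomial.taylor r P).coeff n = P.coeff n + (n + 1) * P.leadingCoeff * r := by
  rw [Polynomial.taylor_coeff, Polynomial.eval_eq_sum_range' (n := 2), Finset.sum_range_succ,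
    Finset.sum_range_one, Polynomial.hasseDeriv_coeff, Polynomial.hasseDeriv_coeff,
    Polynomial.leadingCoeff, hn]
  · simp [add_comm 1 n]
  · have := Polynomial.natDegree_hasseDeriv_le P n
    omega

/-- **Newton–Puiseux**: a monic polynomial over `ℂ{t}` has a root in `ℂ{t^(1/k)}` for some `k`. -/
theorem exists_root_ramify (d : ℕ) (hd : d ≠ 0) (P : Polynomial (convergentSeries Unit))
    (hP : P.Monic) (hPd : P.natDegree = d) :
    ∃ (k : ℕ+) (η : convergentSeries Unit), P.eval₂ (ramify k :
        ConvSeriesOne →+* ConvSeriesOne) η = 0 := by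
  classical
  induction d using Nat.strong_induction_on generalizing P with
  | _ d ih =>
  obtain ⟨n, rfl⟩ := Nat.exists_eq_succ_of_ne_zero hd
  set r : convergentSeries Unit := (-((n : ℂ) + 1)⁻¹) • P.coeff n with hr
  set P' := Polynomial.taylor r P with hP'
  have hP'd : P'.natDegree = n + 1 := by rw [hP', Polynomial.natDegree_taylor, hPd]
  have hP'm : P'.Monic := by
    rw [hP', Polynomial.Monic, Polynomial.leadingCoeff_taylor]; exact hP
  have hP'n : P'.coeff n = 0 := by
    have h1 : (n : ℂ) + 1 ≠ 0 := by exact_mod_cast n.succ_ne_zero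
    have h2 : ((n : convergentSeries Unit) + 1) = algebraMap ℂ _ ((n : ℂ) + 1) := by simp
    rw [hP', taylor_coeff_pred P r hPd, hP.leadingCoeff, mul_one, hr, h2, ← Algebra.smul_def,
      smul_smul, mul_neg, mul_inv_cancel₀ h1, neg_smul, one_smul, add_neg_cancel]
  suffices h : ∃ (k : ℕ+) (η : convergentSeries Unit), P'.eval₂ (ramify k :
      ConvSeriesOne →+* ConvSeriesOne) η = 0 by
    obtain ⟨k, η, h⟩ := h
    refine ⟨k, η + ramify k r, ?_⟩
    rw [hP', Polynomial.taylor_apply, Polynomial.eval₂_comp] at h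
    simpa using h
  clear_value P'
  by_cases hall : ∀ j < n + 1, P'.coeff j = 0
  · have : P' = Polynomial.X ^ (n + 1) := by
      refine hP'm.as_sum.trans ?_
      rw [hP'd, Finset.sum_eq_zero, add_zero]
      intro j hj
      rw [hall j (Finset.mem_range.mp hj), map_zero, zero_mul]
    exact ⟨1, 0, by simp [this]⟩
  push Not at hall
  have hfac : ∀ j, ∃ (v : ℕ) (b : convergentSeries Unit),
      P'.coeff j ≠ 0 → eval₀ _ b ≠ 0 ∧ P'.coeff j = X () ^ v * b := by
    intro j
    by_cases hj : P'.coeff j = 0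
    · exact ⟨0, 0, fun h => absurd hj h⟩
    · obtain ⟨v, hv⟩ := exists_isRegularOfOrder hj
      obtain ⟨b, hb⟩ := isRegularOfOrder_iff.mp hv
      exact ⟨v, b, fun _ => hb⟩
  choose v b hvb using hfac
  -- Newton polygon: `j₀` minimizes `v j / (d - j)`, where `d = n + 1` and `v j` is the order of the
  -- `j`-th coefficient. After `t ↦ t ^ (d - j₀)` the minimal slope is the integer `v j₀`. Roots can
  -- then be divided by `t ^ v j₀`, which leaves a monic `Q` with coefficients `c j` in `ℂ{t}` and
  -- `c j₀` a unit.
  obtain ⟨j₀, hj₀, hmin⟩ := Finset.exists_min_image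
    ((Finset.range (n + 1)).filter fun j => P'.coeff j ≠ 0)
    (fun j => (v j : ℚ) / ((n + 1 - j : ℕ) : ℚ)) (by
      obtain ⟨j, hj, hj'⟩ := hall
      exact ⟨j, by simp [hj, hj']⟩)
  simp only [Finset.mem_filter, Finset.mem_range] at hj₀ hmin
  obtain ⟨hj₀n, hj₀0⟩ := hj₀
  have hmin' : ∀ j < n + 1, P'.coeff j ≠ 0 → v j₀ * (n + 1 - j) ≤ (n + 1 - j₀) * v j := by
    intro j hj hj0
    have h1 := hmin j ⟨hj, hj0⟩
    rw [div_le_div_iff₀ (by exact_mod_cast Nat.sub_pos_of_lt hj₀n)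
      (by exact_mod_cast Nat.sub_pos_of_lt hj)] at h1
    rw [mul_comm _ (v j)]
    exact_mod_cast h1
  let k₀ : ℕ+ := ⟨n + 1 - j₀, Nat.sub_pos_of_lt hj₀n⟩
  let c : ℕ → convergentSeries Unit := fun j => if P'.coeff j = 0 then 0 else
    X () ^ ((n + 1 - j₀) * v j - v j₀ * (n + 1 - j)) * ramify k₀ (b j)
  have hcj : ∀ j < n + 1, ramify k₀ (P'.coeff j) = c j * (X () ^ v j₀) ^ (n + 1 - j) := by
    intro j hj
    by_cases hj0 : P'.coeff j = 0
    · simp [c, hj0]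
    · simp only [c, if_neg hj0]
      rw [(hvb j hj0).2, map_mul, map_pow, ramify_X, ← pow_mul, ← pow_mul, mul_right_comm,
          ← pow_add,
        tsub_add_cancel_of_le (hmin' j hj hj0)]
      rfl
  let S : Polynomial (convergentSeries Unit) :=
    ∑ j ∈ Finset.range (n + 1), Polynomial.monomial j (c j)
  have hSdeg : S.degree < (n + 1 : ℕ) := by
    rw [← Polynomial.mem_degreeLT]
    refine Submodule.sum_mem _ fun j hj => Polynomial.mem_degreeLT.mpr ?_
    exact (Polynomial.degree_monomial_le _ _).trans_lt (by exact_mod_cast Finset.mem_range.mp hj)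
  let Q : Polynomial (convergentSeries Unit) := Polynomial.X ^ (n + 1) + S
  have hQm : Q.Monic := Polynomial.monic_X_pow_add hSdeg
  have hQd : Q.natDegree = n + 1 := by
    have : (Polynomial.X ^ (n + 1) : Polynomial (convergentSeries Unit)).natDegree = n + 1 :=
      Polynomial.natDegree_X_pow _
    rw [Polynomial.natDegree_add_eq_left_of_natDegree_lt, this]
    rw [this]
    exact natDegree_lt_of_degree_lt n.succ_ne_zero hSdeg
  have hQc : ∀ j < n + 1, Q.coeff j = c j := by
    intro j hj
    simp only [Q, S, Polynomial.coeff_add, Polynomial.coeff_X_pow, Polynomial.finsetSum_coeff,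
      Polynomial.coeff_monomial]
    rw [if_neg hj.ne, zero_add, Finset.sum_ite_eq', if_pos (Finset.mem_range.mpr hj)]
  have hscale : Q.scaleRoots (X () ^ v j₀) = P'.map (ramify k₀ :
      ConvSeriesOne →+* ConvSeriesOne) := by
    ext1 j
    rw [Polynomial.coeff_scaleRoots, Polynomial.coeff_map, hQd, RingHom.coe_coe]
    rcases lt_trichotomy j (n + 1) with hj | rfl | hj
    · rw [hQc j hj, hcj j hj]
    · rw [← hP'd]
      conv_lhs => rw [hP'd, ← hQd]
      rw [Polynomial.coeff_natDegree, Polynomial.coeff_natDegree, hQm.leadingCoeff,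
        hP'm.leadingCoeff, hQd]
      simp
    · rw [Polynomial.coeff_eq_zero_of_natDegree_lt (by omega),
        Polynomial.coeff_eq_zero_of_natDegree_lt (by omega), zero_mul, map_zero]
  have hQ₀d : (Q.map (eval₀ Unit : ConvSeriesOne →+* ℂ)).natDegree = n + 1 := by
    rw [hQm.natDegree_map, hQd]
  obtain ⟨z, hz⟩ := IsAlgClosed.exists_root (Q.map (eval₀ Unit : ConvSeriesOne →+* ℂ))
    (Polynomial.degree_ne_of_natDegree_ne (by rw [hQ₀d]; exact n.succ_ne_zero))
  -- A root of full multiplicity would make `Q` at `t = 0` equal to `(X - z) ^ (n + 1)`. The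
  -- vanishing coefficient of degree `n` gives `z = 0`, contradicting that `c j₀` is nonzero at the
  -- origin.
  have hlt : (Q.map (eval₀ Unit : ConvSeriesOne →+* ℂ)).rootMultiplicity z < n + 1 := by
    have hle := Polynomial.natDegree_le_of_dvd
      (Polynomial.pow_rootMultiplicity_dvd (Q.map (eval₀ Unit : ConvSeriesOne →+* ℂ)) z)
      (hQm.map _).ne_zero
    rw [Polynomial.natDegree_pow, Polynomial.natDegree_X_sub_C, mul_one, hQ₀d] at hle
    refine lt_of_le_of_ne hle fun h => ?_
    have h1 : Q.map (eval₀ Unit : ConvSeriesOne →+* ℂ) = (Polynomial.X - Polynomial.C z) ^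
        (n + 1) := by
      refine (Polynomial.eq_of_monic_of_dvd_of_natDegree_le
        ((Polynomial.monic_X_sub_C z).pow _) (hQm.map _) ?_ ?_)
      · rw [← h]; exact Polynomial.pow_rootMultiplicity_dvd _ _
      · rw [hQ₀d]; simp
    have h2 : ∀ j < n + 1, eval₀ Unit (c j) = (-z) ^ (n + 1 - j) * (n + 1).choose j := by
      intro j hj
      rw [← Polynomial.coeff_X_add_C_pow, map_neg, ← sub_eq_add_neg, ← h1, Polynomial.coeff_map,
          hQc j hj]
      rfl
    have h3 := h2 n (Nat.lt_succ_self n)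
    have hz0 : z = 0 := by
      have : (n : ℂ) + 1 ≠ 0 := by exact_mod_cast n.succ_ne_zero
      simpa [c, hP'n, this] using h3
    have h4 := h2 j₀ hj₀n
    rw [hz0, neg_zero, zero_pow (Nat.sub_ne_zero_of_lt hj₀n), zero_mul] at h4
    simp only [c, if_neg hj₀0] at h4
    rw [mul_comm (v j₀), tsub_self, pow_zero, one_mul, eval₀_ramify] at h4
    exact (hvb j₀ hj₀0).1 h4
  obtain ⟨k, η, hη⟩ := exists_root_of_rootMultiplicity_lt
    (fun e he he0 P hPm hPe => ih e he he0 P hPm hPe) hQm hz hlt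
  have h5 := Polynomial.scaleRoots_eval₂_eq_zero (ramify k : ConvSeriesOne →+* ConvSeriesOne)
      (s := X () ^ v j₀) hη
  rw [hscale, Polynomial.eval₂_map] at h5
  have h6 : (ramify (k₀ * k) : ConvSeriesOne →+* ConvSeriesOne) =
      (ramify k : ConvSeriesOne →+* ConvSeriesOne).comp
        (ramify k₀ : ConvSeriesOne →+* ConvSeriesOne) :=
    RingHom.ext fun f => (ramify_ramify k₀ k f).symm
  exact ⟨k₀ * k, ramify k (X () ^ v j₀) * η, by rw [h6]; exact h5⟩

/-- A monic polynomial over `ℂ{t}` splits over `ℂ{t^(1/k)}` for some `k`. -/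
theorem exists_map_ramify_eq_prod (P : Polynomial (convergentSeries Unit)) (hP : P.Monic) :
    ∃ (k : ℕ+) (s : Multiset (convergentSeries Unit)),
      P.map (ramify k : ConvSeriesOne →+* ConvSeriesOne) =
          (s.map fun η => Polynomial.X - Polynomial.C η).prod := by
  induction hd : P.natDegree generalizing P with
  | zero =>
    refine ⟨1, 0, ?_⟩
    rw [(hP.natDegree_eq_zero).mp hd]
    simp
  | succ d ih =>
    obtain ⟨k, η, hη⟩ := exists_root_ramify (d + 1) d.succ_ne_zero P hP hd
    rw [← Polynomial.eval_map] at hη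
    obtain ⟨P₁, hP₁⟩ := Polynomial.dvd_iff_isRoot.mpr hη
    have hm : P₁.Monic := (Polynomial.monic_X_sub_C η).of_mul_monic_left (hP₁ ▸ hP.map _)
    have hd₁ : P₁.natDegree = d := by
      have h1 := congrArg Polynomial.natDegree hP₁
      rw [hP.natDegree_map, hd, (Polynomial.monic_X_sub_C η).natDegree_mul hm,
        Polynomial.natDegree_X_sub_C] at h1
      omega
    obtain ⟨k₁, s, hs⟩ := ih P₁ hm hd₁
    refine ⟨k * k₁, ramify k₁ η ::ₘ s, ?_⟩
    have h2 : (ramify (k * k₁) : ConvSeriesOne →+* ConvSeriesOne) =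
        (ramify k₁ : ConvSeriesOne →+* ConvSeriesOne).comp (ramify k :
            ConvSeriesOne →+* ConvSeriesOne) :=
      RingHom.ext fun f => (ramify_ramify k k₁ f).symm
    rw [h2, ← Polynomial.map_map, hP₁, Polynomial.map_mul, hs]
    simp

end convergentSeries

/-! ### Extending homomorphisms along integral extensions -/

/-- A ring homomorphism to an algebraically closed field extends along integral extensions. -/
theorem exists_ringHom_comp_algebraMap_eq {B A Ω : Type*} [CommRing B] [CommRing A] [Algebra B A]
    [Algebra.IsIntegral B A] [Field Ω] [IsAlgClosed Ω] (ψ : B →+* Ω)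
    (h : RingHom.ker (algebraMap B A) ≤ RingHom.ker ψ) :
    ∃ θ : A →+* Ω, θ.comp (algebraMap B A) = ψ := by
  set q := RingHom.ker ψ with hq
  have : q.IsPrime := RingHom.ker_isPrime ψ
  -- Lying over provides a prime `Q` above `ker ψ`; the domain `A ⧸ Q` is then algebraic over `B ⧸
  -- ker ψ`, which embeds in `Ω`.
  obtain ⟨Q, -, hQ, hQq⟩ := Ideal.exists_ideal_over_prime_of_isIntegral q (⊥ : Ideal A)
    (by rwa [← RingHom.ker_eq_comap_bot])
  have : Q.LiesOver q := ⟨hQq.symm⟩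
  have : IsDomain (A ⧸ Q) := Ideal.Quotient.isDomain Q
  have : Module.IsTorsionFree (B ⧸ q) (A ⧸ Q) :=
    Module.isTorsionFree_iff_algebraMap_injective.mpr (FaithfulSMul.algebraMap_injective _ _)
  let _ : Algebra (B ⧸ q) Ω := (RingHom.kerLift ψ).toAlgebra
  have hinj : Function.Injective (algebraMap (B ⧸ q) Ω) := RingHom.kerLift_injective ψ
  have : Module.IsTorsionFree (B ⧸ q) Ω := Module.isTorsionFree_iff_algebraMap_injective.mpr hinj
  have : Algebra.IsAlgebraic (B ⧸ q) (A ⧸ Q) := Algebra.IsIntegral.isAlgebraic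
  let l : (A ⧸ Q) →ₐ[B ⧸ q] Ω := IsAlgClosed.lift
  refine ⟨(l : (A ⧸ Q) →+* Ω).comp (Ideal.Quotient.mk Q), RingHom.ext fun b => ?_⟩
  have h1 := l.commutes (Ideal.Quotient.mk q b)
  rw [Ideal.Quotient.algebraMap_mk_of_liesOver] at h1
  exact h1.trans (RingHom.kerLift_mk ψ b)

theorem exists_ringHom_comp_eq {D C Ω : Type*} [CommRing D] [CommRing C] [CommRing Ω]
    {j : C →+* Ω} (hj : Function.Injective j) (Θ : D →+* Ω) (h : ∀ d, ∃ c, j c = Θ d) :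
    ∃ φ : D →+* C, ∀ d, j (φ d) = Θ d := by
  choose g hg using h
  exact ⟨{ toFun := g
           map_one' := hj (by simp [hg])
           map_zero' := hj (by simp [hg])
           map_mul' := fun x y => hj (by simp [hg])
           map_add' := fun x y => hj (by simp [hg]) }, hg⟩

theorem Ideal.IsPrime.exists_surjective_ringHom.{u} {D : Type u} [CommRing D] {p : Ideal D}
    (hp : p.IsPrime) : ∃ (A : Type u) (_ : CommRing A) (_ : IsDomain A) (π : D →+* A),
      Function.Surjective π ∧ ∀ x, π x = 0 ↔ x ∈ p :=
  ⟨D ⧸ p, inferInstance, Ideal.Quotient.isDomain p, Ideal.Quotient.mk p,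
    Ideal.Quotient.mk_surjective, fun _ => Ideal.Quotient.eq_zero_iff_mem⟩

theorem isIntegral_of_forall_eq_eval₂ {B A : Type*} [CommRing B] [CommRing A] {ι : B →+* A} {y : A}
    {W : Polynomial B} (hWm : W.Monic) (hWy : W.eval₂ ι y = 0)
    (hgen : ∀ a, ∃ R : Polynomial B, a = R.eval₂ ι y) : ι.IsIntegral := by
  algebraize [ι]
  have hyint : IsIntegral B y := ⟨W, hWm, hWy⟩
  intro a
  obtain ⟨R, rfl⟩ := hgen a
  rw [Polynomial.eval₂_eq_sum_range]
  change IsIntegral B _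
  exact IsIntegral.sum _ fun i _ => (isIntegral_algebraMap (x := R.coeff i)).mul (hyint.pow i)

/-- A substitute for the norm: some coefficient of an integral equation of `a` is a multiple of `a`
without being zero in `A`. It moves the condition on `h` down to the base ring. -/
theorem exists_dvd_map_ne_zero {B A : Type*} [CommRing B] [CommRing A] [IsDomain A] {ι : B →+* A}
    (hι : ι.IsIntegral) {a : A} (ha : a ≠ 0) : ∃ b, a ∣ ι b ∧ ι b ≠ 0 := by
  obtain ⟨G, hGm, hG⟩ := hι a
  have : (Ideal.comap ι ⊥).IsPrime := Ideal.comap_isPrime _ _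
  obtain ⟨i, hi, hi'⟩ := Ideal.exists_coeff_mem_comap_sdiff_comap_of_root_mem_sdiff
    (f := ι) (I := ⊥) (J := Ideal.span {a}) bot_le (r := a)
    ⟨Ideal.mem_span_singleton_self _, by simpa using ha⟩ (p := G) (hGm.map _).ne_zero
        (by simpa using hG)
  exact ⟨G.coeff i, Ideal.mem_span_singleton.mp hi, fun h0 => hi' (by simpa using h0)⟩

/-- Extension of a homomorphism to a simple integral extension `A = B[y]` when an integral equation
of `y` splits in the target. -/
theorem exists_ringHom_comp_eq_of_map_eq_prod {B A C : Type*} [CommRing B] [CommRing A] [CommRing C]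
    [IsDomain C] {ι : B →+* A} {y : A} {W : Polynomial B} (hWm : W.Monic) (hWy : W.eval₂ ι y = 0)
    (hgen : ∀ a, ∃ R : Polynomial B, a = R.eval₂ ι y) {χ : B →+* C}
    (hχ : RingHom.ker ι ≤ RingHom.ker χ) {s : Multiset C}
    (hs : W.map χ = (s.map fun η => Polynomial.X - Polynomial.C η).prod) :
    ∃ φ : A →+* C, φ.comp ι = χ := by
  have hint := isIntegral_of_forall_eq_eval₂ hWm hWy hgen
  let Ω := AlgebraicClosure (FractionRing C)
  let j : C →+* Ω := (algebraMap (FractionRing C) Ω).comp (algebraMap _ _)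
  have hj : Function.Injective j :=
    (algebraMap (FractionRing C) Ω).injective.comp (IsFractionRing.injective _ _)
  obtain ⟨θ, hθ⟩ : ∃ θ : A →+* Ω, θ.comp ι = j.comp χ := by
    let _ := ι.toAlgebra
    have : Algebra.IsIntegral B A := ⟨hint⟩
    refine exists_ringHom_comp_algebraMap_eq (A := A) (j.comp χ) fun x hx => ?_
    rw [RingHom.mem_ker, RingHom.comp_apply, RingHom.mem_ker.mp (hχ hx), map_zero]
  have hθeval : ∀ R : Polynomial B, θ (R.eval₂ ι y) = R.eval₂ (j.comp χ) (θ y) := by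
    intro R
    rw [Polynomial.hom_eval₂, hθ]
  -- `θ y` is a root of the image of `W`, which already splits over `C`. As `A` is generated by `y`
  -- over `B`, all of `θ` then takes values in `C`.
  obtain ⟨η, hη⟩ : ∃ η, j η = θ y := by
    have h1 := hθeval W
    rw [hWy, map_zero, ← Polynomial.eval₂_map, ← Polynomial.eval_map, hs,
      Polynomial.map_multiset_prod, Polynomial.eval_multiset_prod, Multiset.map_map,
      Multiset.map_map, eq_comm, Multiset.prod_eq_zero_iff, Multiset.mem_map] at h1
    obtain ⟨η, -, h2⟩ := h1
    refine ⟨η, ?_⟩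
    simpa [sub_eq_zero, eq_comm (a := j η)] using h2
  obtain ⟨φ, hφ⟩ := exists_ringHom_comp_eq hj θ fun a => by
    obtain ⟨R, rfl⟩ := hgen a
    exact ⟨R.eval₂ χ η, by rw [hθeval, Polynomial.hom_eval₂, hη]⟩
  exact ⟨φ, RingHom.ext fun b => hj ((hφ _).trans (DFunLike.congr_fun hθ b))⟩

/-! ### Curve selection by induction on the number of variables -/

namespace convergentSeries

open MvPowerSeries

variable {σ τ : Type*}

/-- Every nonzero function on the germ of a reduced irreducible subspace in the variables `σ`
restricts to a nonzero function on some curve. -/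
def HasCurveSelection (σ : Type*) : Prop :=
  ∀ p : Ideal (convergentSeries σ), p.IsPrime → ∀ h ∉ p,
    ∃ φ : convergentSeries σ →ₐ[ℂ] convergentSeries Unit, (∀ f ∈ p, φ f = 0) ∧ φ h ≠ 0

theorem exists_curve_of_leftInverse (α : convergentSeries σ →ₐ[ℂ] convergentSeries τ)
    (β : convergentSeries τ →ₐ[ℂ] convergentSeries σ) (hαβ : ∀ x, β (α x) = x)
    {p : Ideal (convergentSeries σ)} {h : convergentSeries σ}
    (H : ∃ φ : convergentSeries τ →ₐ[ℂ] convergentSeries Unit,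
      (∀ f ∈ p.comap β, φ f = 0) ∧ φ (α h) ≠ 0) :
    ∃ φ : convergentSeries σ →ₐ[ℂ] convergentSeries Unit, (∀ f ∈ p, φ f = 0) ∧ φ h ≠ 0 := by
  obtain ⟨φ, hφ, hφh⟩ := H
  exact ⟨φ.comp α, fun f hf => hφ _ (show β (α f) ∈ p by rwa [hαβ]), hφh⟩

theorem HasCurveSelection.of_equiv [Finite σ] [Finite τ] (e : σ ≃ τ) (H : HasCurveSelection σ) :
    HasCurveSelection τ := by
  intro p hp h hh
  let α : convergentSeries τ →ₐ[ℂ] convergentSeries σ := subst (fun i => X (e.symm i)) (by simp)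
  let β : convergentSeries σ →ₐ[ℂ] convergentSeries τ := subst (fun i => X (e i)) (by simp)
  have hαβ : ∀ x, β (α x) = x := by
    intro x
    conv_rhs => rw [← subst_X_self x]
    simp only [α, β]
    rw [subst_subst]
    congr 2
    funext i
    simp
  exact exists_curve_of_leftInverse α β hαβ
    (H _ (hp.comap β) (α h) (by rwa [Ideal.mem_comap, hαβ]))

theorem HasCurveSelection.of_isEmpty [IsEmpty σ] : HasCurveSelection σ := by
  intro p hp h hh
  refine ⟨(Algebra.ofId ℂ _).comp (eval₀ σ), fun f hf => ?_, fun h0 => hh ?_⟩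
  · have : eval₀ σ f = 0 := by
      by_contra h0
      exact hp.ne_top (Ideal.eq_top_of_isUnit_mem _ hf (isUnit_of_eval₀_ne_zero h0))
    simp [this]
  · have h1 : eval₀ σ h = 0 := by
      simpa using congrArg (eval₀ Unit) h0
    have h2 : h = 0 := by
      refine Subtype.ext (MvPowerSeries.ext fun m => ?_)
      rw [Subsingleton.elim m 0]
      exact h1
    rw [h2]
    exact p.zero_mem

/-- The induction step: lift a curve from the base of the finite map given by Weierstrass division,
after ramifying it. -/
theorem exists_curve_of_isRegularOfOrder {τ : Type} [Finite τ] (ih : HasCurveSelection τ)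
    {p : Ideal (convergentSeries (Option τ))} (hp : p.IsPrime) {f : convergentSeries (Option τ)}
    (hf : f ∈ p) {k : ℕ} (hk : IsRegularOfOrder (f : MvPowerSeries (Option τ) ℂ) none k)
    {h : convergentSeries (Option τ)} (hh : h ∉ p) :
    ∃ φ : convergentSeries (Option τ) →ₐ[ℂ] convergentSeries Unit,
      (∀ f ∈ p, φ f = 0) ∧ φ h ≠ 0 := by
  obtain ⟨A, _, _, π, hπ, hπ0⟩ := hp.exists_surjective_ringHom
  set ι : convergentSeries τ →+* A :=
    π.comp (incl τ : convergentSeries τ →+* convergentSeries (Option τ)) with hι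
  have hdiv : ∀ g : convergentSeries (Option τ), ∃ R : Polynomial (convergentSeries τ),
      R.degree < k ∧ π g = R.eval₂ ι (π (X none)) := by
    intro g
    obtain ⟨q, R, hR, h⟩ := exists_weierstrass_division_polynomial hk g
    refine ⟨R, hR, ?_⟩
    rw [h, map_add, map_mul, (hπ0 _).mpr hf, mul_zero, zero_add,
      Polynomial.hom_eval₂]
  have hgen : ∀ a, ∃ R : Polynomial (convergentSeries τ), a = R.eval₂ ι (π (X none)) := by
    intro a
    obtain ⟨g, rfl⟩ := hπ a
    obtain ⟨R, -, hR⟩ := hdiv g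
    exact ⟨R, hR⟩
  obtain ⟨R₀, hR₀, hyR₀⟩ := hdiv (X none ^ k)
  have hWm : (Polynomial.X ^ k - R₀).Monic := Polynomial.monic_X_pow_sub hR₀
  have hWy : (Polynomial.X ^ k - R₀).eval₂ ι (π (X none)) = 0 := by
    rw [Polynomial.eval₂_sub, ← hyR₀, map_pow, Polynomial.eval₂_X_pow, sub_self]
  -- A curve that does not kill `b` cannot lift to one that kills `h`, since `π h` divides `ι b`.
  obtain ⟨b, ⟨a, hba⟩, hb0⟩ := exists_dvd_map_ne_zero
    (isIntegral_of_forall_eq_eval₂ hWm hWy hgen) (a := π h)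
    (fun h0 => hh ((hπ0 _).mp h0))
  obtain ⟨φ', hφ'p, hφ'b⟩ := ih (RingHom.ker ι) (RingHom.ker_isPrime _) b hb0
  obtain ⟨l, s, hs⟩ := exists_map_ramify_eq_prod
    ((Polynomial.X ^ k - R₀).map (φ' : convergentSeries τ →+* convergentSeries Unit)) (hWm.map _)
  rw [Polynomial.map_map] at hs
  obtain ⟨φ, hφ⟩ := exists_ringHom_comp_eq_of_map_eq_prod hWm hWy hgen
    (fun x hx => RingHom.mem_ker.mpr
      ((congrArg (ramify l) (hφ'p x hx)).trans (map_zero (ramify l)))) hs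
  have hφι : ∀ x, φ (ι x) = ramify l (φ' x) := DFunLike.congr_fun hφ
  -- The extension was built as a ring homomorphism only. It is `ℂ`-linear because constants come
  -- from the base, where it agrees with the `ℂ`-algebra map `ramify l ∘ φ'`.
  refine ⟨{ φ.comp π with commutes' := fun c => ?_ }, fun g hg => ?_, fun h0 => ?_⟩
  · have h1 := hφι (algebraMap ℂ _ c)
    rw [AlgHom.commutes, AlgHom.commutes] at h1
    refine Eq.trans ?_ h1
    change φ (π _) = φ (π (incl τ _))
    rw [AlgHom.commutes]
  · change φ (π g) = 0
    rw [(hπ0 _).mpr hg, map_zero]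
  · have h2 : φ (π h) = 0 := h0
    have h1 := hφι b
    rw [hba, map_mul, h2, zero_mul] at h1
    exact hφ'b (ramify_injective l (h1.symm.trans (map_zero _).symm))

theorem HasCurveSelection.option {τ : Type} [Finite τ] (ih : HasCurveSelection τ) :
    HasCurveSelection (Option τ) := by
  intro p hp h hh
  by_cases hbot : p = ⊥
  · obtain ⟨c, hc⟩ := exists_line_ne_zero (f := h) fun h0 => hh (h0 ▸ p.zero_mem)
    refine ⟨line c, fun f hf => ?_, hc⟩
    rw [hbot, Ideal.mem_bot] at hf
    rw [hf, map_zero]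
  · obtain ⟨f, hf, hf0⟩ := Submodule.exists_mem_ne_zero_of_ne_bot hbot
    obtain ⟨α, β, hαβ, k, hk⟩ := exists_linear_change hf0
    exact exists_curve_of_leftInverse α β hαβ (exists_curve_of_isRegularOfOrder ih (hp.comap β)
      (f := α f) (by rwa [Ideal.mem_comap, hαβ]) hk (by rwa [Ideal.mem_comap, hαβ]))

/-- The **curve selection lemma**. -/
theorem hasCurveSelection (σ : Type) [Finite σ] : HasCurveSelection σ := by
  have H : ∀ (σ : Type) [Finite σ], Finite σ → HasCurveSelection σ := by
    intro σ _
    refine Finite.induction_empty_option (P := fun σ => Finite σ → HasCurveSelection σ)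
      (fun {α β} e H hβ => ?_) (fun _ => HasCurveSelection.of_isEmpty)
      (fun {α} _ H _ => (H inferInstance).option) σ
    have : Finite α := Finite.of_equiv β e.symm
    exact (H this).of_equiv e
  exact H σ inferInstance

end convergentSeries

/-! ### From curve selection to the Nullstellensatz -/

theorem mem_curvePoints_iff {n : ℕ} {I : Ideal (ConvSeries n)}
    {φ : LocalAlgHom (ConvSeries n) ConvSeriesOne} :
    φ ∈ curvePoints I ↔ ∀ f ∈ I, φ.1 f = 0 := by
  constructor
  · rintro ⟨ψ, hψ⟩ f hf
    rw [← hψ, AlgHom.comp_apply, Ideal.Quotient.mkₐ_eq_mk, Ideal.Quotient.eq_zero_iff_mem.mpr hf,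
      map_zero]
  · intro h
    -- The descended map is local: a class with unit image has a representative with unit image,
    -- which is a unit because `φ` is local.
    refine ⟨⟨Ideal.Quotient.liftₐ I φ.1 h, ⟨fun a ha => ?_⟩⟩, AlgHom.ext fun f => rfl⟩
    obtain ⟨f, rfl⟩ := Ideal.Quotient.mk_surjective a
    have := φ.2
    exact (isUnit_of_map_unit φ.1 f ha).map (Ideal.Quotient.mk I)

theorem exists_localAlgHom_of_notMem {n : ℕ} {p : Ideal (ConvSeries n)} (hp : p.IsPrime)
    {h : ConvSeries n} (hh : h ∉ p) :
    ∃ φ : LocalAlgHom (ConvSeries n) ConvSeriesOne, (∀ f ∈ p, φ.1 f = 0) ∧ φ.1 h ≠ 0 := by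
  obtain ⟨φ, hφ⟩ := convergentSeries.hasCurveSelection (Fin n) p hp h hh
  exact ⟨⟨φ, convergentSeries.isLocalHom_algHom φ⟩, hφ⟩

/-- If `f ∈ √I` avoided a prime `p ⊇ J`, a curve killing `p` but not `f` would be a point of `J`,
hence of `I`, and would kill a power of `f`. -/
theorem radical_le_of_curvePoints_subset {n : ℕ} {I J : Ideal (ConvSeries n)}
    (h : curvePoints J ⊆ curvePoints I) : I.radical ≤ J.radical := by
  intro f hf
  rw [Ideal.radical_eq_sInf J, Ideal.mem_sInf]
  rintro p ⟨hJp, hp⟩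
  by_contra hfp
  obtain ⟨φ, hφ, hφf⟩ := exists_localAlgHom_of_notMem hp hfp
  obtain ⟨m, hm⟩ := hf
  have h1 := mem_curvePoints_iff.mp (h (mem_curvePoints_iff.mpr fun g hg => hφ g (hJp hg))) _ hm
  rw [map_pow] at h1
  exact hφf (eq_zero_of_pow_eq_zero h1)

theorem curvePoints_radical {n : ℕ} (I : Ideal (ConvSeries n)) :
    curvePoints I.radical = curvePoints I := by
  ext φ
  rw [mem_curvePoints_iff, mem_curvePoints_iff]
  refine ⟨fun h f hf => h f (Ideal.le_radical hf), fun h f ⟨m, hm⟩ => ?_⟩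
  have h1 := h _ hm
  rw [map_pow] at h1
  exact eq_zero_of_pow_eq_zero h1

theorem theoremV4p2 (n : ℕ) :
    (∀ p : Ideal (ConvSeries n), p.IsPrime → ∀ h : ConvSeries n, h ∉ p →
      ∃ φ : LocalAlgHom (ConvSeries n) ConvSeriesOne, (∀ f ∈ p, φ.1 f = 0) ∧ φ.1 h ≠ 0) ∧
    (∀ I J : Ideal (ConvSeries n), I ≠ ⊤ → J ≠ ⊤ →
      (curvePoints I = curvePoints J ↔ I.radical = J.radical)) := by
  refine ⟨fun p hp h hh => exists_localAlgHom_of_notMem hp hh, fun I J _ _ => ⟨fun h => ?_,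
      fun h => ?_⟩⟩
  · exact le_antisymm (radical_le_of_curvePoints_subset h.ge)
      (radical_le_of_curvePoints_subset h.le)
  · rw [← curvePoints_radical I, h, curvePoints_radical]
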